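/- Let $T>0$ and let $P=\partial_t+\sum_{j=1}^n A^j\partial_{x_j}+B$ be a symmetric hyperbolic operator on $[0,T]\times\mathbb R^n$: the coefficients $A^j,B$ are $C^\infty$ functions on $[0,T]\times\mathbb R^n$ with values in the complex $m\times m$ matrices, they are uniformly bounded together with all their derivatives, and every $A^j(t,x)$ is Hermitian. Put $\mathrm{div}A=\sum_{j=1}^n\partial_{x_j}A^j$. The $L^\infty$-norm of a matrix-valued function is the supremum of the pointwise operator norm with respect to the Euclidean norm $|\cdot|$ on $\mathbb C^m$. (i) Let $0<R_1<R_2$, let $B_{R_2}\subset\mathbb R^n$ be the closed ball of radius $R_2$ about $0$, and for $\Theta\in[0,1]$, $y\in B_{R_2}$ let $\psi(\Theta,y)=(\Theta T,y)$ if $|y|\le R_1$ and $\psi(\Theta,y)=\big(\Theta T\frac{R_2-|y|}{R_2-R_1},y\big)$ if $|y|>R_1$. Let $\mathcal H_\Theta=\psi(\Theta,B_{R_2})$, let $\mathcal L=\bigcup_{0\le\Theta\le1}\mathcal H_\Theta$ be the standard lens of thickness $T$ and radii $R_1,R_2$, and for $\Theta\in(0,1]$ let $\nu_\Theta=(\nu_\Theta^0,\dots,\nu_\Theta^n)$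 be the unit normal field of $\mathcal H_\Theta$ that points out of $\bigcup_{0\le\tau\le\Theta}\mathcal H_\tau$; it is defined at the points $(t,x)\in\mathcal H_\Theta$ with $|x|<R_2$, $|x|\ne R_1$. Suppose that $$\Big\langle\eta,\Big(\nu_\Theta^0(t,x)\,\mathbb I_m+\sum_{j=1}^n\nu_\Theta^j(t,x)A^j(t,x)\Big)\eta\Big\rangle\ \ge\ \tfrac12|\eta|^2$$ for all $\Theta\in(0,1]$, all such $(t,x)\in\mathcal H_\Theta$ and all $\eta\in\mathbb C^m$. Put $\alpha(\mathcal L)=1+\|\mathrm{div}A-B-B^*\|_{L^\infty(\mathcal L)}$. Then for every $U\in C^\infty([0,T]\times\mathbb R^n)^m$ $$\|U\|_{L^2(\mathcal L)}^2\le 2T\,e^{2T\alpha(\mathcal L)}\big(\|U\|_{L^2(\mathcal H_0)}^2+\|PU\|_{L^2(\mathcal L)}^2\big).$$ (ii) Let $\Omega_t=(0,t)\times\mathbb R^n$ and $\beta(t)=1+\|\mathrm{div}A(t,\cdot)-B(t,\cdot)-B^*(t,\cdot)\|_{L^\infty(\mathbb R^n)}$. Then for every $U\in C^1([0,T],L^2(\mathbb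 R^n))^m\cap C^0([0,T],H^1(\mathbb R^n))^m$ and all $t\in[0,T]$ $$\|U(t,\cdot)\|_{L^2(\mathbb R^n)}^2\le e^{\int_0^t\beta(s)\,ds}\big(\|U(0,\cdot)\|_{L^2(\mathbb R^n)}^2+\|PU\|_{L^2(\Omega_t)}^2\big).$$ -/

import Mathlib

open MeasureTheory Set
open scoped ContDiff Matrix.Norms.L2Operator

noncomputable section

namespace SymHyp

/-- Euclidean space `ℝⁿ`. -/
abbrev Rn (n : ℕ) : Type := EuclideanSpace ℝ (Fin n)

/-- `ℂᵐ` with its standard Hermitian scalar product. -/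
abbrev Cm (m : ℕ) : Type := EuclideanSpace ℂ (Fin m)

/-- Complex `m × m` matrices; the norm in force is the operator norm on `ℂᵐ`. -/
abbrev Mat (m : ℕ) : Type := Matrix (Fin m) (Fin m) ℂ

/-- The linear action of a matrix on `ℂᵐ`. -/
abbrev act {m : ℕ} (M : Mat m) (v : Cm m) : Cm m := Matrix.toEuclideanCLM (𝕜 := ℂ) M v

/-- The `j`-th standard unit vector of `ℝⁿ`. -/
abbrev unitVec {n : ℕ} (j : Fin n) : Rn n := EuclideanSpace.single j (1 : ℝ)

/-- The closed strip `[0,T] × ℝⁿ`. -/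
def strip (n : ℕ) (T : ℝ) : Set (ℝ × Rn n) := Icc 0 T ×ˢ univ

/-! ### Symmetric hyperbolic operators -/

/-- `F` is smooth on `[0,T] × ℝⁿ` (up to the boundary) and bounded there together with all its
derivatives. -/
def SmoothBounded {n m : ℕ} (T : ℝ) (F : ℝ × Rn n → Mat m) : Prop :=
  ContDiffOn ℝ ∞ F (strip n T) ∧
    ∀ k : ℕ, ∃ C : ℝ, ∀ p ∈ strip n T, ‖iteratedFDerivWithin ℝ k F (strip n T) p‖ ≤ C

/-- The operator `∂_t + ∑ⱼ Aʲ ∂_{xⱼ} + B` is symmetric hyperbolic on `[0,T] × ℝⁿ`: the coefficient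
matrices are smooth and uniformly bounded together with all derivatives, and the `Aʲ` are
Hermitian. -/
structure IsSymmetricHyperbolic {n m : ℕ} (T : ℝ) (A : Fin n → ℝ × Rn n → Mat m)
    (B : ℝ × Rn n → Mat m) : Prop where
  smoothBounded_A : ∀ j, SmoothBounded T (A j)
  smoothBounded_B : SmoothBounded T B
  hermitian : ∀ j, ∀ p ∈ strip n T, (A j p).IsHermitian

/-- The principal symbol `σ(t,x;τ,ξ) = τ I + ∑ⱼ ξⱼ Aʲ(t,x)`. -/
def symbol {n m : ℕ} (A : Fin n → ℝ × Rn n → Mat m) (p : ℝ × Rn n) (ν : ℝ × Rn n) : Mat m :=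
  (ν.1 : ℂ) • (1 : Mat m) + ∑ j, (ν.2 j : ℂ) • A j p

/-- `div A = ∑ⱼ ∂_{xⱼ} Aʲ` at the point `p = (t,x)`. -/
def divA {n m : ℕ} (A : Fin n → ℝ × Rn n → Mat m) (p : ℝ × Rn n) : Mat m :=
  ∑ j, fderiv ℝ (fun y : Rn n => A j (p.1, y)) p.2 (unitVec j)

/-- The zeroth order matrix `div A - B - B*`. -/
def zeroOrder {n m : ℕ} (A : Fin n → ℝ × Rn n → Mat m) (B : ℝ × Rn n → Mat m)
    (p : ℝ × Rn n) : Mat m :=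
  divA A p - B p - (B p).conjTranspose

/-- `PU = ∂_t U + ∑ⱼ Aʲ ∂_{xⱼ} U + B U` for a function `U` that is differentiable in the classical
sense on `[0,T] × ℝⁿ` (one-sided time derivatives at `t = 0` and `t = T`). -/
def opP {n m : ℕ} (T : ℝ) (A : Fin n → ℝ × Rn n → Mat m) (B : ℝ × Rn n → Mat m)
    (U : ℝ × Rn n → Cm m) (p : ℝ × Rn n) : Cm m :=
  derivWithin (fun s : ℝ => U (s, p.2)) (Icc 0 T) p.1
    + ∑ j, act (A j p) (fderiv ℝ (fun y : Rn n => U (p.1, y)) p.2 (unitVec j))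
    + act (B p) (U p)

/-! ### Standard lenses -/

/-- The standard lens map `ψ(Θ,y)` of thickness `T` and radii `R₁ < R₂`. -/
def lensMap {n : ℕ} (T R₁ R₂ Θ : ℝ) (y : Rn n) : ℝ × Rn n :=
  if ‖y‖ ≤ R₁ then (Θ * T, y) else (Θ * T * ((R₂ - ‖y‖) / (R₂ - R₁)), y)

/-- The slice `𝓗_Θ = ψ(Θ, B_{R₂})`. -/
def lensSlice (n : ℕ) (T R₁ R₂ Θ : ℝ) : Set (ℝ × Rn n) :=
  lensMap T R₁ R₂ Θ '' Metric.closedBall 0 R₂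

/-- The standard lens `𝓛 = ψ([0,1] × B_{R₂})`. -/
def lens (n : ℕ) (T R₁ R₂ : ℝ) : Set (ℝ × Rn n) :=
  (fun q : ℝ × Rn n => lensMap T R₁ R₂ q.1 q.2) '' (Icc 0 1 ×ˢ Metric.closedBall 0 R₂)

/-- The unit normal of `𝓗_Θ` at its point over `x`, pointing out of the part of the lens below
`𝓗_Θ`. It is meaningful for `‖x‖ < R₂`, `‖x‖ ≠ R₁`: there `𝓗_Θ` is locally the hypersurface
`t = Θ T`, respectively the cone `t = Θ T (R₂ - ‖x‖) / (R₂ - R₁)`. -/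
def lensNormal {n : ℕ} (T R₁ R₂ Θ : ℝ) (x : Rn n) : ℝ × Rn n :=
  if ‖x‖ ≤ R₁ then (1, 0)
  else ((R₂ - R₁) / √((Θ * T) ^ 2 + (R₂ - R₁) ^ 2),
    (Θ * T / (√((Θ * T) ^ 2 + (R₂ - R₁) ^ 2) * ‖x‖)) • x)

/-- The quantitative spacelike condition on the lens:
`⟨η, σ(t,x; ν_Θ(t,x)) η⟩ ≥ |η|² / 2` for all `Θ ∈ (0,1]`, all `η ∈ ℂᵐ` and all points `(t,x)` of
`𝓗_Θ` at which the normal exists, that is off the edges `|x| = R₁` and `|x| = R₂`. -/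
def IsSpacelikeLens {n m : ℕ} (A : Fin n → ℝ × Rn n → Mat m) (T R₁ R₂ : ℝ) : Prop :=
  ∀ Θ ∈ Ioc (0 : ℝ) 1, ∀ p ∈ lensSlice n T R₁ R₂ Θ, ‖p.2‖ ≠ R₁ → ‖p.2‖ < R₂ →
    ∀ η : Cm m,
      (1 / 2 : ℝ) * ‖η‖ ^ 2 ≤
        (inner ℂ η (act (symbol A p (lensNormal T R₁ R₂ Θ p.2)) η)).re

/-- `α(𝓛) = 1 + ‖div A - B - B*‖_{L^∞(𝓛)}`. -/
def alphaLens {n m : ℕ} (A : Fin n → ℝ × Rn n → Mat m) (B : ℝ × Rn n → Mat m)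
    (T R₁ R₂ : ℝ) : ℝ :=
  1 + ⨆ p : lens n T R₁ R₂, ‖zeroOrder A B p‖

/-- `‖U‖²` in `L²(𝓗₀)`; the surface measure of the flat slice `𝓗₀ = {0} × B_{R₂}` is the
Lebesgue measure of `ℝⁿ`. -/
def sqNormInitial {n m : ℕ} (T R₁ R₂ : ℝ) (U : ℝ × Rn n → Cm m) : ℝ :=
  ∫ x in {x : Rn n | ((0 : ℝ), x) ∈ lensSlice n T R₁ R₂ 0}, ‖U (0, x)‖ ^ 2

/-- `‖V‖²` in `L²(𝓛)`. -/
def sqNormLens {n m : ℕ} (T R₁ R₂ : ℝ) (V : ℝ × Rn n → Cm m) : ℝ :=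
  ∫ p in lens n T R₁ R₂, ‖V p‖ ^ 2

/-! ### The Sobolev space `H¹(ℝⁿ)ᵐ` -/

/-- `L²(ℝⁿ)ᵐ`. -/
abbrev L2 (n m : ℕ) : Type := Lp (Cm m) 2 (volume : Measure (Rn n))

/-- `g` is the weak partial derivative `∂_{xⱼ} f`. -/
def IsWeakPartial {n m : ℕ} (j : Fin n) (f g : L2 n m) : Prop :=
  ∀ φ : Rn n → ℝ, ContDiff ℝ ∞ φ → HasCompactSupport φ →
    ∫ x, (fderiv ℝ φ x (unitVec j)) • f x = -∫ x, φ x • g x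

theorem integrable_test_smul {n m : ℕ} {φ : Rn n → ℝ} (hφ : Continuous φ)
    (hc : HasCompactSupport φ) (f : L2 n m) : Integrable (fun x => φ x • f x) :=
  ((Lp.memLp f).locallyIntegrable (by norm_num)).integrable_smul_left_of_hasCompactSupport hφ hc

theorem continuous_partial {n : ℕ} {φ : Rn n → ℝ} (hφ : ContDiff ℝ ∞ φ) (v : Rn n) :
    Continuous (fun x => fderiv ℝ φ x v) :=
  (hφ.continuous_fderiv (by simp)).clm_apply continuous_const

theorem hasCompactSupport_partial {n : ℕ} {φ : Rn n → ℝ} (hc : HasCompactSupport φ) (v : Rn n) :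
    HasCompactSupport (fun x => fderiv ℝ φ x v) :=
  hc.fderiv_apply (𝕜 := ℝ) v

theorem IsWeakPartial.add {n m : ℕ} {j : Fin n} {f g f' g' : L2 n m} (h : IsWeakPartial j f g)
    (h' : IsWeakPartial j f' g') : IsWeakPartial j (f + f') (g + g') := by
  intro φ hφ hc
  have e : ∀ (χ : Rn n → ℝ), Continuous χ → HasCompactSupport χ → ∀ u v : L2 n m,
      ∫ x, χ x • (u + v) x = (∫ x, χ x • u x) + ∫ x, χ x • v x := by
    intro χ h1 h2 u v
    rw [← integral_add (integrable_test_smul h1 h2 u) (integrable_test_smul h1 h2 v)]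
    refine integral_congr_ae ?_
    filter_upwards [Lp.coeFn_add u v] with x hx
    rw [hx, Pi.add_apply, smul_add]
  rw [e _ (continuous_partial hφ _) (hasCompactSupport_partial hc _), e _ hφ.continuous hc,
    h φ hφ hc, h' φ hφ hc, neg_add]

theorem IsWeakPartial.smul {n m : ℕ} {j : Fin n} {f g : L2 n m} (c : ℂ)
    (h : IsWeakPartial j f g) : IsWeakPartial j (c • f) (c • g) := by
  intro φ hφ hc
  have e : ∀ (χ : Rn n → ℝ) (u : L2 n m),
      ∫ x, χ x • (c • u) x = c • ∫ x, χ x • u x := by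
    intro χ u
    rw [← integral_smul]
    refine integral_congr_ae ?_
    filter_upwards [Lp.coeFn_smul c u] with x hx
    rw [hx, Pi.smul_apply, smul_comm]
  rw [e, e, h φ hφ hc, smul_neg]

theorem IsWeakPartial.zero {n m : ℕ} (j : Fin n) : IsWeakPartial j (0 : L2 n m) 0 := by
  intro φ hφ hc
  have e : ∀ χ : Rn n → ℝ, ∫ x, χ x • (0 : L2 n m) x = 0 := by
    intro χ
    refine integral_eq_zero_of_ae ?_
    filter_upwards [Lp.coeFn_zero (Cm m) 2 (volume : Measure (Rn n))] with x hx
    rw [hx, Pi.zero_apply, smul_zero]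
  rw [e, e, neg_zero]

/-- The Sobolev space `H¹(ℝⁿ)ᵐ = W^{1,2}(ℝⁿ)ᵐ`: the functions `f ∈ L²` all of whose first order
weak partial derivatives are in `L²`. An element is `f` together with its (unique) weak
derivatives, so that the inherited norm is `(‖f‖² + ∑ⱼ ‖∂ⱼ f‖²)^{1/2}`. -/
def H1 (n m : ℕ) : Submodule ℂ (WithLp 2 (L2 n m × PiLp 2 (fun _ : Fin n => L2 n m))) where
  carrier := {u | ∀ j, IsWeakPartial j u.fst (u.snd j)}
  add_mem' := fun hu hv j => (hu j).add (hv j)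
  zero_mem' := fun j => IsWeakPartial.zero j
  smul_mem' := fun c _ hu j => (hu j).smul c

/-- The inclusion `H¹ ⊆ L²`. -/
def H1.toL2 {n m : ℕ} (u : H1 n m) : L2 n m := u.1.fst

/-- The weak derivative `∂_{xⱼ} : H¹ → L²`. -/
def H1.partialDeriv {n m : ℕ} (j : Fin n) (u : H1 n m) : L2 n m := u.1.snd j

/-- `(PU)(s,x)` for a curve `U : [0,T] → H¹(ℝⁿ)ᵐ` that is differentiable as a curve in `L²`:
`∂_t U` is the derivative in `L²`, `∂_{xⱼ} U` is the weak derivative. -/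
def opPH1 {n m : ℕ} (T : ℝ) (A : Fin n → ℝ × Rn n → Mat m) (B : ℝ × Rn n → Mat m)
    (U : ℝ → H1 n m) (s : ℝ) (x : Rn n) : Cm m :=
  derivWithin (fun r : ℝ => H1.toL2 (U r)) (Icc 0 T) s x
    + ∑ j, act (A j (s, x)) (H1.partialDeriv j (U s) x)
    + act (B (s, x)) (H1.toL2 (U s) x)

/-- `‖V‖²` in `L²(Ω_t)`, `Ω_t = (0,t) × ℝⁿ`, for a curve `V` in `L²(ℝⁿ)`, that is
`∫₀ᵗ ‖V(s,·)‖²_{L²(ℝⁿ)} ds`. -/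
def sqNormOmega {n m : ℕ} (V : ℝ → Rn n → Cm m) (t : ℝ) : ℝ :=
  ∫ s in (0 : ℝ)..t, ∫ x, ‖V s x‖ ^ 2

/-- `β(t) = 1 + ‖div A(t,·) - B(t,·) - B*(t,·)‖_{L^∞(ℝⁿ)}`. -/
def beta {n m : ℕ} (A : Fin n → ℝ × Rn n → Mat m) (B : ℝ × Rn n → Mat m) (t : ℝ) : ℝ :=
  1 + ⨆ x : Rn n, ‖zeroOrder A B (t, x)‖

end SymHyp

end

noncomputable section

namespace SymHyp

/-! ### Calculus on the strip -/

section Strip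

variable {n m : ℕ} {T : ℝ}

/-! Both estimates are energy estimates. Since the `Aʲ` are Hermitian, the current `(|U|², Re⟨U,
AʲU⟩)` has space-time divergence `2 Re⟨U, PU⟩ + Re⟨U, ZU⟩` with `Z = div A - B - B*`. By
Cauchy-Schwarz and `2ab ≤ a² + b²` this is at most `(1 + ‖Z‖)|U|² + |PU|²`, and `gronwall_le` turns
such a bound into an exponential estimate.

On the lens, let `g` be its height (`profile`), so that `t = Θ g(y)` and `dt dy = g dΘ dy`. The
divergence theorem `integral_fluxDensity_sub` compares the flux through the slice `Θ` with the flux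
through `𝓗₀`. With respect to `dy` the flux uses the conormal `(1, -Θ∇g)`, which is the unit normal
divided by its time component `ν⁰ ≤ 1`; hence the spacelike condition bounds the flux below by `½ ∫
|U|² dy` (`half_energyDensity_le_fluxDensity`). As `g ≤ T`, the mass `G(τ)` of `|U|²` below the
slice `τ` obeys `G' ≤ 2T(D + αG)`, `G(0) = 0`, where `D` is the sum of the two squared norms on the
right-hand side. Gronwall on `[0,1]` gives the factor `2T exp(2Tα)`.

On the whole space the energy is `‖U(t)‖²` in `L²`. The one delicate point is the integration by
parts `2 Re⟨f, M ∂ⱼf⟩ = -Re⟨f, (∂ⱼM) f⟩` for `f` in `H¹` (`inner_mulOp_weakPartial`). No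
approximation by smooth functions is made: a weak derivative in `L²` is the strong derivative of the
translation group (`hasDerivAt_shift`), and the formula results from differentiating a
translation-invariant inner product. -/

theorem convex_strip (n : ℕ) (T : ℝ) : Convex ℝ (strip n T) :=
  (convex_Icc 0 T).prod convex_univ

theorem uniqueDiffOn_strip (n : ℕ) (hT : 0 < T) : UniqueDiffOn ℝ (strip n T) :=
  (uniqueDiffOn_Icc hT).prod uniqueDiffOn_univ

theorem mem_strip {p : ℝ × Rn n} : p ∈ strip n T ↔ p.1 ∈ Icc 0 T := by
  simp [strip]

variable {E : Type*} [NormedAddCommGroup E]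

/-- `F` is bounded and Lipschitz on the strip, with the constant `C`. -/
structure BoundedLipschitz (T : ℝ) (F : ℝ × Rn n → E) (C : ℝ) : Prop where
  bound : ∀ p ∈ strip n T, ‖F p‖ ≤ C
  lip : ∀ p ∈ strip n T, ∀ q ∈ strip n T, ‖F p - F q‖ ≤ C * ‖p - q‖

theorem BoundedLipschitz.nonneg (hT : 0 ≤ T) {F : ℝ × Rn n → E} {C : ℝ}
    (h : BoundedLipschitz T F C) : 0 ≤ C :=
  (norm_nonneg _).trans (h.bound (0, 0) (mem_strip.2 (by simpa using hT)))

theorem BoundedLipschitz.add {F G : ℝ × Rn n → E} {C D : ℝ}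
    (hF : BoundedLipschitz T F C) (hG : BoundedLipschitz T G D) :
    BoundedLipschitz T (fun p => F p + G p) (C + D) where
  bound p hp := (norm_add_le _ _).trans (add_le_add (hF.bound p hp) (hG.bound p hp))
  lip p hp q hq := by
    rw [add_sub_add_comm, add_mul]
    exact (norm_add_le _ _).trans (add_le_add (hF.lip p hp q hq) (hG.lip p hp q hq))

theorem BoundedLipschitz.neg {F : ℝ × Rn n → E} {C : ℝ}
    (hF : BoundedLipschitz T F C) : BoundedLipschitz T (fun p => -F p) C where
  bound p hp := by simpa using hF.bound p hp
  lip p hp q hq := by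
    rw [neg_sub_neg, norm_sub_rev]
    exact hF.lip p hp q hq

theorem BoundedLipschitz.sum {ι : Type*} (s : Finset ι) {F : ι → ℝ × Rn n → E} {C : ι → ℝ}
    (hF : ∀ i ∈ s, BoundedLipschitz T (F i) (C i)) :
    BoundedLipschitz T (fun p => ∑ i ∈ s, F i p) (∑ i ∈ s, C i) where
  bound p hp := (norm_sum_le _ _).trans (Finset.sum_le_sum fun i hi => (hF i hi).bound p hp)
  lip p hp q hq := by
    rw [← Finset.sum_sub_distrib, Finset.sum_mul]
    exact (norm_sum_le _ _).trans (Finset.sum_le_sum fun i hi => (hF i hi).lip p hp q hq)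

theorem BoundedLipschitz.congr {F G : ℝ × Rn n → E} {C : ℝ}
    (hF : BoundedLipschitz T F C) (h : ∀ p ∈ strip n T, G p = F p) : BoundedLipschitz T G C where
  bound p hp := by rw [h p hp]; exact hF.bound p hp
  lip p hp q hq := by rw [h p hp, h q hq]; exact hF.lip p hp q hq

variable [NormedSpace ℝ E]

theorem hasDerivWithinAt_time {F : ℝ × Rn n → E} {F' : ℝ × Rn n →L[ℝ] E} {p : ℝ × Rn n}
    (h : HasFDerivWithinAt F F' (strip n T) p) :
    HasDerivWithinAt (fun s => F (s, p.2)) (F' (1, 0)) (Icc 0 T) p.1 := by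
  have h1 : HasDerivWithinAt (fun s : ℝ => (s, p.2)) ((1 : ℝ), (0 : Rn n)) (Icc 0 T) p.1 :=
    ((hasDerivAt_id p.1).prodMk (hasDerivAt_const p.1 p.2)).hasDerivWithinAt
  exact HasFDerivWithinAt.comp_hasDerivWithinAt p.1 (t := strip n T) h h1
    (fun s hs => mem_strip.2 hs)

/-- The strip is the whole space in the `x` directions, so even at `t = 0` and `t = T` the
derivative within the strip restricts to an unconditional spatial derivative. -/
theorem hasFDerivAt_space {F : ℝ × Rn n → E} {F' : ℝ × Rn n →L[ℝ] E} {p : ℝ × Rn n}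
    (hp : p ∈ strip n T) (h : HasFDerivWithinAt F F' (strip n T) p) :
    HasFDerivAt (fun y => F (p.1, y)) (F'.comp (ContinuousLinearMap.inr ℝ ℝ (Rn n))) p.2 := by
  have h1 : HasFDerivWithinAt (fun y : Rn n => (p.1, y))
      (ContinuousLinearMap.inr ℝ ℝ (Rn n)) univ p.2 :=
    (hasFDerivAt_prodMk_right p.1 p.2).hasFDerivWithinAt
  have h2 := HasFDerivWithinAt.comp p.2 (t := strip n T) h h1
    (fun y _ => mem_strip.2 (mem_strip.1 hp))
  exact hasFDerivWithinAt_univ.1 h2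

theorem differentiableOn_strip {F : ℝ × Rn n → E} (h : ContDiffOn ℝ ∞ F (strip n T)) :
    DifferentiableOn ℝ F (strip n T) :=
  h.differentiableOn (by simp)

theorem continuousOn_fderivWithin_strip (hT : 0 < T) {F : ℝ × Rn n → E}
    (h : ContDiffOn ℝ ∞ F (strip n T)) :
    ContinuousOn (fderivWithin ℝ F (strip n T)) (strip n T) :=
  h.continuousOn_fderivWithin (uniqueDiffOn_strip n hT) (by simp)

theorem continuousOn_fderivWithin_apply_strip (hT : 0 < T) {F : ℝ × Rn n → E}
    (h : ContDiffOn ℝ ∞ F (strip n T)) (v : ℝ × Rn n) :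
    ContinuousOn (fun p => fderivWithin ℝ F (strip n T) p v) (strip n T) :=
  (continuousOn_fderivWithin_strip hT h).clm_apply continuousOn_const

theorem divA_eq {A : Fin n → ℝ × Rn n → Mat m}
    (hA : ∀ j, DifferentiableOn ℝ (A j) (strip n T)) {p : ℝ × Rn n} (hp : p ∈ strip n T) :
    divA A p = ∑ j, fderivWithin ℝ (A j) (strip n T) p (0, unitVec j) := by
  refine Finset.sum_congr rfl fun j _ => ?_
  rw [(hasFDerivAt_space hp (hA j p hp).hasFDerivWithinAt).fderiv]
  rfl

theorem opP_eq (hT : 0 < T) (A : Fin n → ℝ × Rn n → Mat m) (B : ℝ × Rn n → Mat m)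
    {U : ℝ × Rn n → Cm m} (hU : DifferentiableOn ℝ U (strip n T)) {p : ℝ × Rn n}
    (hp : p ∈ strip n T) :
    opP T A B U p = fderivWithin ℝ U (strip n T) p (1, 0)
      + ∑ j, act (A j p) (fderivWithin ℝ U (strip n T) p (0, unitVec j)) + act (B p) (U p) := by
  have h := (hU p hp).hasFDerivWithinAt
  rw [opP, (hasDerivWithinAt_time h).derivWithin (uniqueDiffOn_Icc hT p.1 (mem_strip.1 hp)),
    (hasFDerivAt_space hp h).fderiv]
  rfl

/-- The strip is convex, so by the mean value inequality bounds on derivatives up to order two give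
Lipschitz bounds for `F` and its first derivative. The Lipschitz derivative is what makes Taylor
remainders uniform in `x` later. -/
theorem SmoothBounded.exists_boundedLipschitz (hT : 0 < T) {F : ℝ × Rn n → Mat m}
    (hF : SmoothBounded T F) :
    ∃ C, BoundedLipschitz T F C ∧ BoundedLipschitz T (fderivWithin ℝ F (strip n T)) C := by
  obtain ⟨hs, hb⟩ := hF
  obtain ⟨C₀, h0⟩ := hb 0
  obtain ⟨C₁, h1⟩ := hb 1
  obtain ⟨C₂, h2⟩ := hb 2
  have hu := uniqueDiffOn_strip n hT
  have b0 : ∀ p ∈ strip n T, ‖F p‖ ≤ C₀ := fun p hp => by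
    simpa using h0 p hp
  have b1 : ∀ p ∈ strip n T, ‖fderivWithin ℝ F (strip n T) p‖ ≤ C₁ := fun p hp => by
    rw [← norm_iteratedFDerivWithin_one _ (hu p hp)]
    exact h1 p hp
  have b2 : ∀ p ∈ strip n T,
      ‖fderivWithin ℝ (fderivWithin ℝ F (strip n T)) (strip n T) p‖ ≤ C₂ := fun p hp => by
    have e := norm_iteratedFDerivWithin_one (𝕜 := ℝ) (fderivWithin ℝ F (strip n T)) (hu p hp)
    rw [norm_iteratedFDerivWithin_fderivWithin hu hp] at e
    exact e.symm.trans_le (h2 p hp)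
  have d1 : DifferentiableOn ℝ (fderivWithin ℝ F (strip n T)) (strip n T) :=
    (hs.fderivWithin (m := ∞) hu (by simp)).differentiableOn (by simp)
  refine ⟨max C₀ (max C₁ C₂), ⟨fun p hp => (b0 p hp).trans (le_max_left _ _), fun p hp q hq => ?_⟩,
    ⟨fun p hp => (b1 p hp).trans ((le_max_left _ _).trans (le_max_right _ _)),
      fun p hp q hq => ?_⟩⟩
  · exact (convex_strip n T).norm_image_sub_le_of_norm_fderivWithin_le
      (differentiableOn_strip hs)
      (fun x hx => (b1 x hx).trans ((le_max_left _ _).trans (le_max_right _ _))) hq hp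
  · exact (convex_strip n T).norm_image_sub_le_of_norm_fderivWithin_le d1
      (fun x hx => (b2 x hx).trans ((le_max_right _ _).trans (le_max_right _ _))) hq hp

theorem BoundedLipschitz.clm_apply {V : Type*} [NormedAddCommGroup V] [NormedSpace ℝ V]
    {F : ℝ × Rn n → V →L[ℝ] E} {C : ℝ} (hF : BoundedLipschitz T F C) (v : V) :
    BoundedLipschitz T (fun p => F p v) (C * ‖v‖) where
  bound p hp := (F p).le_of_opNorm_le (hF.bound p hp) v
  lip p hp q hq := by
    rw [← sub_apply, mul_right_comm]
    exact (F p - F q).le_of_opNorm_le (hF.lip p hp q hq) v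

theorem BoundedLipschitz.conjTranspose {F : ℝ × Rn n → Mat m} {C : ℝ}
    (hF : BoundedLipschitz T F C) : BoundedLipschitz T (fun p => (F p).conjTranspose) C where
  bound p hp := by rw [Matrix.l2_opNorm_conjTranspose]; exact hF.bound p hp
  lip p hp q hq := by
    rw [← Matrix.conjTranspose_sub, Matrix.l2_opNorm_conjTranspose]
    exact hF.lip p hp q hq

/-- Boundedness makes the suprema in `alphaLens` and `beta` genuine (a real `⨆` over an unbounded
family is `0`); the Lipschitz bound makes `beta` continuous in time. -/
theorem exists_boundedLipschitz_zeroOrder (hT : 0 < T) {A : Fin n → ℝ × Rn n → Mat m}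
    {B : ℝ × Rn n → Mat m} (hP : IsSymmetricHyperbolic T A B) :
    ∃ C, BoundedLipschitz T (zeroOrder A B) C := by
  choose CA hA hA' using fun j => (hP.smoothBounded_A j).exists_boundedLipschitz hT
  obtain ⟨CB, hB, -⟩ := hP.smoothBounded_B.exists_boundedLipschitz hT
  refine ⟨_, (((BoundedLipschitz.sum Finset.univ
    fun j _ => (hA' j).clm_apply (0, unitVec j)).add hB.neg).add hB.conjTranspose.neg).congr fun p hp => ?_⟩
  rw [zeroOrder, divA_eq (fun j => differentiableOn_strip (hP.smoothBounded_A j).1) hp,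
    sub_eq_add_neg, sub_eq_add_neg]

end Strip

/-! ### The matrix action as a real bilinear map -/

section Action

variable {m : ℕ}

/-- The action of matrices on vectors as a continuous `ℝ`-bilinear map. -/
def actL (m : ℕ) : Mat m →L[ℝ] Cm m →L[ℝ] Cm m :=
  LinearMap.mkContinuous₂
    (LinearMap.mk₂ ℝ (fun (M : Mat m) (v : Cm m) => act M v)
      (fun M N v => by simp [act]) (fun c M v => by
        rw [act, act, ← Complex.coe_smul, map_smul, smul_apply,
          Complex.coe_smul])
      (fun M v w => by simp [act]) (fun c M v => by
        rw [act, act, ContinuousLinearMap.map_smul_of_tower])) 1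
    (fun M v => by
      rw [one_mul]
      exact (Matrix.toEuclideanCLM (𝕜 := ℂ) M).le_opNorm v)

@[simp] theorem actL_apply (M : Mat m) (v : Cm m) : actL m M v = act M v := rfl

theorem norm_act_le (M : Mat m) (v : Cm m) : ‖act M v‖ ≤ ‖M‖ * ‖v‖ :=
  (Matrix.toEuclideanCLM (𝕜 := ℂ) M).le_opNorm v

theorem inner_act_conjTranspose (M : Mat m) (v w : Cm m) :
    inner ℂ v (act M.conjTranspose w) = inner ℂ (act M v) w := by
  have : Matrix.toEuclideanCLM (𝕜 := ℂ) M.conjTranspose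
      = ContinuousLinearMap.adjoint (Matrix.toEuclideanCLM (𝕜 := ℂ) M) :=
    map_star (Matrix.toEuclideanCLM (n := Fin m) (𝕜 := ℂ)) M
  rw [act, this, ContinuousLinearMap.adjoint_inner_right]

theorem inner_act_of_isHermitian {M : Mat m} (hM : M.IsHermitian) (v w : Cm m) :
    inner ℂ v (act M w) = inner ℂ (act M v) w := by
  rw [← inner_act_conjTranspose, hM.eq]

end Action

/-! ### Multiplication operators on `L²` -/

section Multiplication

open scoped BoundedContinuousFunction

variable {n m : ℕ}

theorem memLp_act (M : Rn n →ᵇ Mat m) (f : L2 n m) :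
    MemLp (fun x => act (M x) (f x)) 2 (volume : Measure (Rn n)) := by
  refine MemLp.of_le_mul (c := ‖M‖) (Lp.memLp f) ?_ (Filter.Eventually.of_forall fun x => ?_)
  · have h1 := Continuous.aestronglyMeasurable (μ := volume)
      ((actL m).continuous.comp M.continuous)
    have h2 := h1.prodMk (Lp.aestronglyMeasurable f)
    exact (isBoundedBilinearMap_apply (𝕜 := ℝ) (E := Cm m)
      (F := Cm m)).continuous.comp_aestronglyMeasurable h2
  · exact (norm_act_le _ _).trans
      (mul_le_mul_of_nonneg_right (M.norm_coe_le_norm x) (norm_nonneg _))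

/-- Multiplication of an `L²` function by a bounded continuous matrix function. -/
def mulOp (n m : ℕ) : (Rn n →ᵇ Mat m) →L[ℝ] L2 n m →L[ℝ] L2 n m :=
  LinearMap.mkContinuous₂
    (LinearMap.mk₂ ℝ (fun (M : Rn n →ᵇ Mat m) (f : L2 n m) => (memLp_act M f).toLp)
      (fun M N f => by
        rw [← MemLp.toLp_add]
        refine MemLp.toLp_congr _ _ (Filter.Eventually.of_forall fun x => ?_)
        exact congrArg (fun L => L (f x)) ((actL m).map_add (M x) (N x)))
      (fun c M f => by
        rw [← MemLp.toLp_const_smul]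
        refine MemLp.toLp_congr _ _ (Filter.Eventually.of_forall fun x => ?_)
        exact congrArg (fun L => L (f x)) ((actL m).map_smul c (M x)))
      (fun M f g => by
        rw [← MemLp.toLp_add]
        refine MemLp.toLp_congr _ _ ?_
        filter_upwards [Lp.coeFn_add f g] with x hx
        rw [hx]
        exact (actL m (M x)).map_add (f x) (g x))
      (fun c M f => by
        rw [← MemLp.toLp_const_smul]
        refine MemLp.toLp_congr _ _ ?_
        filter_upwards [Lp.coeFn_smul c f] with x hx
        rw [hx]
        exact (actL m (M x)).map_smul c (f x))) 1
    (fun M f => by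
      rw [one_mul]
      refine Lp.norm_le_mul_norm_of_ae_le_mul ?_
      filter_upwards [(memLp_act M f).coeFn_toLp] with x hx
      simp only [LinearMap.mk₂_apply]
      rw [hx]
      exact (norm_act_le _ _).trans
        (mul_le_mul_of_nonneg_right (M.norm_coe_le_norm x) (norm_nonneg _)))

theorem coeFn_mulOp (M : Rn n →ᵇ Mat m) (f : L2 n m) :
    mulOp n m M f =ᵐ[volume] fun x => act (M x) (f x) :=
  (memLp_act M f).coeFn_toLp

theorem norm_mulOp_le (M : Rn n →ᵇ Mat m) (f : L2 n m) : ‖mulOp n m M f‖ ≤ ‖M‖ * ‖f‖ := by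
  refine Lp.norm_le_mul_norm_of_ae_le_mul ?_
  filter_upwards [coeFn_mulOp M f] with x hx
  rw [hx]
  exact (norm_act_le _ _).trans
    (mul_le_mul_of_nonneg_right (M.norm_coe_le_norm x) (norm_nonneg _))

theorem inner_mulOp_of_conjTranspose {M N : Rn n →ᵇ Mat m}
    (h : ∀ x, N x = (M x).conjTranspose) (f g : L2 n m) :
    inner ℂ f (mulOp n m N g) = inner ℂ (mulOp n m M f) g := by
  rw [L2.inner_def, L2.inner_def]
  refine integral_congr_ae ?_
  filter_upwards [coeFn_mulOp M f, coeFn_mulOp N g] with x h1 h2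
  rw [h1, h2, h x, inner_act_conjTranspose]

end Multiplication

/-! ### Translations and weak derivatives -/

section Translation

open scoped BoundedContinuousFunction Topology

variable {n m : ℕ}

/-- Translation `f ↦ f(· + v)` on `L²`. -/
def shift (v : Rn n) : L2 n m →ₗᵢ[ℂ] L2 n m :=
  Lp.compMeasurePreservingₗᵢ ℂ (fun x => x + v) (measurePreserving_add_right volume v)

theorem coeFn_shift (v : Rn n) (f : L2 n m) : shift v f =ᵐ[volume] fun x => f (x + v) :=
  Lp.coeFn_compMeasurePreserving f (measurePreserving_add_right volume v)

theorem shift_zero (f : L2 n m) : shift 0 f = f := by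
  refine Lp.ext ?_
  filter_upwards [coeFn_shift 0 f] with x hx
  rw [hx, add_zero]

/-- The translations depend continuously on the vector in the compact-open topology, and composition
of an `L²` function with measure-preserving maps is continuous for it. -/
theorem continuous_shift {X : Type*} [TopologicalSpace X] {v : X → Rn n} (hv : Continuous v)
    (f : L2 n m) : Continuous (fun x => shift (v x) f) := by
  let g : X → C(Rn n, Rn n) := fun x => ⟨fun y => y + v x, by fun_prop⟩
  have hg : Continuous g :=
    ContinuousMap.continuous_of_continuous_uncurry _ (by
      change Continuous fun q : X × Rn n => q.2 + v q.1
      fun_prop)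
  exact (continuous_const (y := f)).compMeasurePreservingLp hg
    (fun x => measurePreserving_add_right volume (v x)) (by norm_num)

/-- Translation of bounded continuous functions. -/
def shiftB (v : Rn n) (M : Rn n →ᵇ Mat m) : Rn n →ᵇ Mat m :=
  M.compContinuous ⟨fun x => x + v, by fun_prop⟩

@[simp] theorem shiftB_apply (v : Rn n) (M : Rn n →ᵇ Mat m) (x : Rn n) :
    shiftB v M x = M (x + v) := rfl

theorem shift_mulOp (v : Rn n) (M : Rn n →ᵇ Mat m) (f : L2 n m) :
    shift v (mulOp n m M f) = mulOp n m (shiftB v M) (shift v f) := by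
  refine Lp.ext ?_
  have h := (measurePreserving_add_right volume v).quasiMeasurePreserving.ae (coeFn_mulOp M f)
  filter_upwards [coeFn_shift v (mulOp n m M f), coeFn_mulOp (shiftB v M) (shift v f),
    coeFn_shift v f, h] with x h1 h2 h3 h4
  rw [h1, h2, h3, h4, shiftB_apply]

/-- The pairing of an `L²` function with a test function. -/
def testPairing (φ : Lp ℝ 2 (volume : Measure (Rn n))) : L2 n m →L[ℝ] Cm m :=
  (ContinuousLinearMap.lsmul ℝ ℝ : ℝ →L[ℝ] Cm m →L[ℝ] Cm m).lpPairing volume 2 2 φ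

theorem exists_pairing {φ : Rn n → ℝ} (hφ : Continuous φ) (hc : HasCompactSupport φ) :
    ∃ L : L2 n m →L[ℝ] Cm m, ∀ f, L f = ∫ x, φ x • f x := by
  have hm : MemLp φ 2 (volume : Measure (Rn n)) := hφ.memLp_of_hasCompactSupport hc
  refine ⟨testPairing hm.toLp, fun f => ?_⟩
  rw [testPairing, ContinuousLinearMap.lpPairing_eq_integral]
  refine integral_congr_ae ?_
  filter_upwards [hm.coeFn_toLp] with x hx
  simp [hx]

theorem integral_smul_shift (φ : Rn n → ℝ) (v : Rn n) (f : L2 n m) :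
    ∫ x, φ x • shift v f x = ∫ x, φ (x - v) • f x := by
  rw [← integral_add_right_eq_self (fun x => φ (x - v) • f x) v]
  refine integral_congr_ae ?_
  filter_upwards [coeFn_shift v f] with x hx
  rw [hx, add_sub_cancel_right]

theorem contDiff_translate {φ : Rn n → ℝ} (hφ : ContDiff ℝ ∞ φ) (v : Rn n) :
    ContDiff ℝ ∞ (fun x => φ (x - v)) :=
  hφ.comp (contDiff_id.sub contDiff_const)

theorem hasCompactSupport_translate {φ : Rn n → ℝ} (hc : HasCompactSupport φ) (v : Rn n) :
    HasCompactSupport (fun x => φ (x - v)) :=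
  hc.comp_homeomorph (Homeomorph.subRight v)

/-- The integral is the convolution of `f` with `z ↦ φ (-z)` evaluated at `s • e`, so the derivative
falls on the smooth, compactly supported factor. The result is written with the derivative of the
translated test function, to which the definition of a weak derivative applies directly. -/
theorem hasDerivAt_integral_translate {φ : Rn n → ℝ} (hφ : ContDiff ℝ ∞ φ)
    (hc : HasCompactSupport φ) (e : Rn n) (f : L2 n m) (t : ℝ) :
    HasDerivAt (fun s : ℝ => ∫ x, φ (x - s • e) • f x)
      (-∫ x, (fderiv ℝ (fun y => φ (y - t • e)) x e) • f x) t := by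
  let ψ : Rn n → ℝ := fun z => φ (-z)
  let L : Cm m →L[ℝ] ℝ →L[ℝ] Cm m := (ContinuousLinearMap.lsmul ℝ ℝ).flip
  have hψ : ContDiff ℝ ∞ ψ := hφ.comp contDiff_neg
  have hψc : HasCompactSupport ψ := hc.comp_homeomorph (Homeomorph.neg _)
  have hf : LocallyIntegrable f (volume : Measure (Rn n)) :=
    (Lp.memLp f).locallyIntegrable (by norm_num)
  have h := hψc.hasFDerivAt_convolution_right (μ := volume) L hf (hψ.of_le (by simp)) (t • e)
  have h1 : HasDerivAt (fun s : ℝ => s • e) e t := by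
    simpa using (hasDerivAt_id t).smul_const e
  have h2 := h.comp_hasDerivAt t h1
  rw [convolution_precompR_apply L hf (hψc.fderiv ℝ) (hψ.continuous_fderiv (by simp))] at h2
  have e1 : (convolution f ψ L volume ∘ fun s : ℝ => s • e)
      = fun s : ℝ => ∫ x, φ (x - s • e) • f x := by
    funext s
    simp [convolution_def, L, ψ]
  rw [e1] at h2
  refine h2.congr_deriv ?_
  rw [convolution_def, ← integral_neg]
  refine integral_congr_ae (Filter.Eventually.of_forall fun x => ?_)
  have hd : ∀ z, HasFDerivAt φ (fderiv ℝ φ z) z := fun z =>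
    (hφ.differentiable (by simp) z).hasFDerivAt
  have d1 : HasFDerivAt (fun y => φ (y - t • e)) (fderiv ℝ φ (x - t • e)) x :=
    HasFDerivAt.congr_fderiv
      ((hd (x - t • e)).comp x ((hasFDerivAt_id x).sub_const (t • e))) (by ext v; simp)
  have d2 : HasFDerivAt ψ (-fderiv ℝ φ (x - t • e)) (t • e - x) := by
    have h3 := (hd (-(t • e - x))).comp (t • e - x) (hasFDerivAt_id (t • e - x)).neg
    exact HasFDerivAt.congr_fderiv h3 (by ext v; simp)
  simp only [d1.fderiv, d2.fderiv, L, ContinuousLinearMap.flip_apply,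
    ContinuousLinearMap.lsmul_apply, neg_apply, neg_smul]

/-- Fundamental theorem of calculus along translations. Paired with a test function, the translation
moves onto that function, where the weak derivative identity gives the derivative in `s`. Since all
test functions see the same value, the two `L²` functions coincide. -/
theorem shift_sub_eq_integral {j : Fin n} {f g : L2 n m} (hfg : IsWeakPartial j f g) (t : ℝ) :
    shift (t • unitVec j) f - f = ∫ s in (0 : ℝ)..t, shift (s • unitVec j) g := by
  have hcont : ∀ u : L2 n m, Continuous fun s : ℝ => shift (s • unitVec j) u := fun u =>
    continuous_shift (by fun_prop) u
  rw [← sub_eq_zero]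
  refine Lp.ext ?_
  refine Filter.EventuallyEq.trans ?_ (Lp.coeFn_zero (Cm m) 2 volume).symm
  refine ae_eq_zero_of_integral_contDiff_smul_eq_zero
    ((Lp.memLp _).locallyIntegrable (by norm_num)) fun φ hφ hc => ?_
  obtain ⟨L, hL⟩ := exists_pairing (m := m) hφ.continuous hc
  have hd : ∀ s : ℝ, HasDerivAt (fun s : ℝ => L (shift (s • unitVec j) f))
      (L (shift (s • unitVec j) g)) s := fun s => by
    have := hasDerivAt_integral_translate hφ hc (unitVec j) f s
    rw [hfg _ (contDiff_translate hφ _) (hasCompactSupport_translate hc _), neg_neg] at this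
    simpa only [hL, integral_smul_shift] using this
  have hi := intervalIntegral.integral_eq_sub_of_hasDerivAt (a := 0) (b := t) (fun s _ => hd s)
    ((L.continuous.comp (hcont g)).intervalIntegrable _ _)
  rw [zero_smul, shift_zero] at hi
  rw [← hL, map_sub, map_sub, ← L.intervalIntegral_comp_comm ((hcont g).intervalIntegrable _ _), hi,
    sub_self]

/-- Translations act continuously on `L²`, so the preceding integral formula can be differentiated
at `0`: the weak derivative is a norm limit of difference quotients. -/
theorem hasDerivAt_shift {j : Fin n} {f g : L2 n m} (hfg : IsWeakPartial j f g) :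
    HasDerivAt (fun s : ℝ => shift (s • unitVec j) f) g 0 := by
  have hcont : Continuous fun s : ℝ => shift (s • unitVec j) g := continuous_shift (by fun_prop) g
  have h := (hcont.integral_hasStrictDerivAt 0 0).hasDerivAt
  rw [zero_smul, shift_zero] at h
  refine (h.add_const f).congr_of_eventuallyEq (Filter.Eventually.of_forall fun t => ?_)
  simp only [← shift_sub_eq_integral hfg, sub_add_cancel]

/-- Translation is an isometry, so the inner product of the translates of `f` and `M f` is constant.
Its derivative at `0` reads `⟨f, M g⟩ + ⟨f, M' f⟩ + ⟨g, M f⟩ = 0`, and the Hermitian symmetry of `M`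
gives the outer terms equal real parts. -/
theorem inner_mulOp_weakPartial {j : Fin n} {f g : L2 n m} (hfg : IsWeakPartial j f g)
    {M M' : Rn n →ᵇ Mat m} (hM : HasDerivAt (fun s : ℝ => shiftB (s • unitVec j) M) M' 0)
    (hH : ∀ x, (M x).IsHermitian) :
    2 * (inner ℂ f (mulOp n m M g)).re = -(inner ℂ f (mulOp n m M' f)).re := by
  have h1 := hasDerivAt_shift hfg
  have h2 : HasDerivAt (fun s : ℝ => mulOp n m (shiftB (s • unitVec j) M)
      (shift (s • unitVec j) f)) (mulOp n m M g + mulOp n m M' f) 0 := by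
    have h := ((mulOp n m).hasFDerivAt_of_bilinear hM.hasFDerivAt h1.hasFDerivAt).hasDerivAt
    have z : shiftB (0 : Rn n) M = M := by ext x; simp
    simpa [shift_zero, z] using h
  have h3 := h1.inner ℂ h2
  have h4 : (fun s : ℝ => inner ℂ (shift (s • unitVec j) f)
      (mulOp n m (shiftB (s • unitVec j) M) (shift (s • unitVec j) f)))
      = fun _ => inner ℂ f (mulOp n m M f) := by
    funext s
    rw [← shift_mulOp, LinearIsometry.inner_map_map]
  rw [h4] at h3
  have h5 := congrArg Complex.re (h3.unique (hasDerivAt_const _ _))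
  have h6 : inner ℂ g (mulOp n m M f) = inner ℂ (mulOp n m M g) f :=
    inner_mulOp_of_conjTranspose (fun x => (hH x).eq.symm) g f
  have z : shiftB (0 : Rn n) M = M := by ext x; simp
  have h7 := inner_re_symm (𝕜 := ℂ) (mulOp n m M g) f
  rw [zero_smul, shift_zero, z, h6, inner_add_right] at h5
  simp only [Complex.add_re, Complex.zero_re] at h5
  simp only [RCLike.re_to_complex] at h7
  linarith

end Translation

/-! ### A Gronwall inequality -/

theorem hasDerivAt_primitive {b : ℝ → ℝ} {t s : ℝ} (hb : ContinuousOn b (Icc 0 t))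
    (hs : s ∈ Ioo 0 t) : HasDerivAt (fun r => ∫ u in (0 : ℝ)..r, b u) (b s) s := by
  refine intervalIntegral.integral_hasDerivAt_right ?_ ?_ ?_
  · refine ContinuousOn.intervalIntegrable_of_Icc hs.1.le (hb.mono ?_)
    exact Icc_subset_Icc_right hs.2.le
  · exact (hb.mono Ioo_subset_Icc_self).stronglyMeasurableAtFilter isOpen_Ioo s hs
  · exact hb.continuousAt (Icc_mem_nhds hs.1 hs.2)

theorem continuousOn_primitive {b : ℝ → ℝ} {t : ℝ} (ht : 0 ≤ t) (hb : ContinuousOn b (Icc 0 t)) :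
    ContinuousOn (fun r => ∫ u in (0 : ℝ)..r, b u) (Icc 0 t) := by
  have h := intervalIntegral.continuousOn_primitive_interval (μ := volume) (f := b) (a := 0)
    (b := t) (by rw [uIcc_of_le ht]; exact hb.integrableOn_Icc)
  rwa [uIcc_of_le ht] at h

/-- Gronwall's inequality with a variable coefficient and an inhomogeneous term. -/
theorem gronwall_le {E b N : ℝ → ℝ} {t : ℝ} (ht : 0 ≤ t) (hE : ContinuousOn E (Icc 0 t))
    (hb : ContinuousOn b (Icc 0 t)) (hN : ContinuousOn N (Icc 0 t))
    (hb0 : ∀ s ∈ Icc 0 t, 0 ≤ b s) (hN0 : ∀ s ∈ Icc 0 t, 0 ≤ N s)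
    (hd : ∀ s ∈ Ioo 0 t, ∃ E', HasDerivAt E E' s ∧ E' ≤ b s * E s + N s) :
    E t ≤ Real.exp (∫ s in (0 : ℝ)..t, b s) * (E 0 + ∫ s in (0 : ℝ)..t, N s) := by
  set β : ℝ → ℝ := fun r => ∫ u in (0 : ℝ)..r, b u with hβ
  set ν : ℝ → ℝ := fun r => ∫ u in (0 : ℝ)..r, N u with hν
  -- The derivative is `e^{-β}(E' - bE) - N ≤ (e^{-β} - 1) N ≤ 0`, as `β ≥ 0`. Dropping the factor
  -- `e^{-β} ≤ 1` in front of `N` is why the plain integral of `N` appears in the conclusion.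
  have key : ∀ s ∈ Ioo 0 t, ∃ d ≤ 0, HasDerivAt (fun r => Real.exp (-β r) * E r - ν r) d s := by
    intro s hs
    obtain ⟨E', h1, h2⟩ := hd s hs
    have hsI := Ioo_subset_Icc_self hs
    refine ⟨_, ?_, (((hasDerivAt_primitive hb hs).neg.exp).mul h1).sub
      (hasDerivAt_primitive hN hs)⟩
    have hβs : 0 ≤ β s := intervalIntegral.integral_nonneg hs.1.le fun u hu =>
      hb0 u ⟨hu.1, hu.2.trans hs.2.le⟩
    have he : Real.exp (-β s) ≤ 1 := Real.exp_le_one_iff.2 (by linarith)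
    have he0 := Real.exp_pos (-β s)
    have := hN0 s hsI
    change Real.exp (-β s) * -b s * E s + Real.exp (-β s) * E' - N s ≤ 0
    nlinarith [mul_le_mul_of_nonneg_left h2 he0.le, mul_le_mul_of_nonneg_right he this]
  have hanti : AntitoneOn (fun r => Real.exp (-β r) * E r - ν r) (Icc 0 t) := by
    refine antitoneOn_of_deriv_nonpos (convex_Icc 0 t) ?_ ?_ ?_
    · exact (((continuousOn_primitive ht hb).neg.rexp).mul hE).sub (continuousOn_primitive ht hN)
    · rw [interior_Icc]
      intro s hs
      obtain ⟨d, -, h⟩ := key s hs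
      exact h.differentiableAt.differentiableWithinAt
    · rw [interior_Icc]
      intro s hs
      obtain ⟨d, h0, h⟩ := key s hs
      rwa [h.deriv]
  have h := hanti (left_mem_Icc.2 ht) (right_mem_Icc.2 ht) ht
  simp only [hβ, hν, intervalIntegral.integral_same, neg_zero, Real.exp_zero, one_mul,
    sub_zero] at h
  have h3 : Real.exp (-∫ s in (0 : ℝ)..t, b s) * E t ≤ E 0 + ∫ s in (0 : ℝ)..t, N s := by linarith
  calc E t = Real.exp (∫ s in (0 : ℝ)..t, b s) * (Real.exp (-∫ s in (0 : ℝ)..t, b s) * E t) := by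
        rw [← mul_assoc, ← Real.exp_add, add_neg_cancel, Real.exp_zero, one_mul]
    _ ≤ _ := mul_le_mul_of_nonneg_left h3 (Real.exp_pos _).le

/-! ### Time slices of the coefficients -/

section Slices

open scoped BoundedContinuousFunction Topology

variable {n m : ℕ} {T : ℝ}

theorem projIcc_mem_strip (hT : 0 ≤ T) (s : ℝ) (x : Rn n) :
    ((projIcc 0 T hT s : ℝ), x) ∈ strip n T :=
  mem_strip.2 (projIcc 0 T hT s).2

/-- The slice at time `s` of a bounded Lipschitz coefficient; `s` is clamped to `[0,T]`. -/
def sliceB (hT : 0 ≤ T) {F : ℝ × Rn n → Mat m} {C : ℝ} (hF : BoundedLipschitz T F C) (s : ℝ) :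
    Rn n →ᵇ Mat m :=
  BoundedContinuousFunction.ofNormedAddCommGroup (fun x => F (projIcc 0 T hT s, x))
    (LipschitzWith.continuous (K := C.toNNReal) (LipschitzWith.of_dist_le_mul fun x y => by
      rw [Real.coe_toNNReal _ (hF.nonneg hT), dist_eq_norm, dist_eq_norm]
      refine (hF.lip _ (projIcc_mem_strip hT s x) _ (projIcc_mem_strip hT s y)).trans_eq ?_
      simp [Prod.norm_def]))
    C (fun x => hF.bound _ (projIcc_mem_strip hT s x))

theorem sliceB_apply (hT : 0 ≤ T) {F : ℝ × Rn n → Mat m} {C : ℝ} (hF : BoundedLipschitz T F C)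
    {s : ℝ} (hs : s ∈ Icc 0 T) (x : Rn n) : sliceB hT hF s x = F (s, x) := by
  change F (projIcc 0 T hT s, x) = F (s, x)
  rw [projIcc_of_mem hT hs]

/-- The Lipschitz bound in time is uniform in `x`, hence continuity holds in the sup norm; clamping
to `[0,T]` does not increase distances. -/
theorem continuous_sliceB (hT : 0 ≤ T) {F : ℝ × Rn n → Mat m} {C : ℝ}
    (hF : BoundedLipschitz T F C) : Continuous (sliceB hT hF) := by
  have hC := hF.nonneg hT
  refine LipschitzWith.continuous (K := C.toNNReal) (LipschitzWith.of_dist_le_mul fun s r => ?_)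
  rw [Real.coe_toNNReal _ hC, BoundedContinuousFunction.dist_le (by positivity)]
  intro x
  rw [dist_eq_norm]
  refine (hF.lip _ (projIcc_mem_strip hT s x) _ (projIcc_mem_strip hT r x)).trans ?_
  refine mul_le_mul_of_nonneg_left ?_ hC
  rw [Prod.norm_def, Prod.snd_sub, sub_self, norm_zero, Prod.fst_sub, Real.norm_eq_abs,
    max_eq_left (abs_nonneg _), Real.dist_eq]
  exact abs_projIcc_sub_projIcc hT

/-- On the ball of radius `‖v‖` about `p` the derivative differs from its value at `p` by at most
`C‖v‖`; the mean value inequality contributes the second factor `‖v‖`. The constant does not depend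
on `p`. -/
theorem norm_taylor_le (hT : 0 < T) {F : ℝ × Rn n → Mat m} {C : ℝ}
    (hd : DifferentiableOn ℝ F (strip n T))
    (hF' : BoundedLipschitz T (fderivWithin ℝ F (strip n T)) C)
    {p : ℝ × Rn n} (hp : p ∈ strip n T) (v : Rn n) :
    ‖F (p.1, p.2 + v) - F p - fderivWithin ℝ F (strip n T) p (0, v)‖ ≤ C * ‖v‖ ^ 2 := by
  have hC := hF'.nonneg hT.le
  have hv : ‖((0 : ℝ), v)‖ = ‖v‖ := by simp [Prod.norm_def]
  have e : (p.1, p.2 + v) - p = ((0 : ℝ), v) := by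
    ext <;> simp
  have h := Convex.norm_image_sub_le_of_norm_hasFDerivWithin_le' (𝕜 := ℝ)
    (s := strip n T ∩ Metric.closedBall p ‖v‖) (f := F) (f' := fderivWithin ℝ F (strip n T))
    (φ := fderivWithin ℝ F (strip n T) p) (C := C * ‖v‖) (x := p) (y := (p.1, p.2 + v))
    (fun q hq => ((hd q hq.1).hasFDerivWithinAt).mono inter_subset_left)
    (fun q hq => (hF'.lip q hq.1 p hp).trans (mul_le_mul_of_nonneg_left
      (by rw [← dist_eq_norm]; exact hq.2) hC))
    ((convex_strip n T).inter (convex_closedBall _ _)) ⟨hp, by simp⟩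
    ⟨mem_strip.2 (mem_strip.1 hp), by rw [Metric.mem_closedBall, dist_eq_norm, e, hv]⟩
  rw [e, hv] at h
  exact h.trans_eq (by ring)

/-- The Taylor remainder is `O(h²)` uniformly in `x`, so the difference quotients converge in the
sup norm, as the product rule for `mulOp` requires. -/
theorem hasDerivAt_shiftB_sliceB (hT : 0 < T) {F : ℝ × Rn n → Mat m} {C : ℝ}
    (hd : DifferentiableOn ℝ F (strip n T)) (hF : BoundedLipschitz T F C)
    (hF' : BoundedLipschitz T (fderivWithin ℝ F (strip n T)) C) (s : ℝ) (e : Rn n) :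
    HasDerivAt (fun h : ℝ => shiftB (h • e) (sliceB hT.le hF s))
      (sliceB hT.le (hF'.clm_apply (0, e)) s) 0 := by
  have hC := hF'.nonneg hT.le
  rw [hasDerivAt_iff_isLittleO_nhds_zero]
  have hO : (fun h : ℝ => shiftB ((0 + h) • e) (sliceB hT.le hF s)
      - shiftB ((0 : ℝ) • e) (sliceB hT.le hF s) - h • sliceB hT.le (hF'.clm_apply (0, e)) s)
      =O[𝓝 0] fun h : ℝ => h ^ 2 := by
    refine Asymptotics.IsBigO.of_bound (C * ‖e‖ ^ 2) (Filter.Eventually.of_forall fun h => ?_)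
    rw [BoundedContinuousFunction.norm_le (by positivity)]
    intro x
    have h1 := norm_taylor_le hT hd hF' (projIcc_mem_strip hT.le s x) (h • e)
    have e1 : ((0 : ℝ), h • e) = h • ((0 : ℝ), e) := by simp
    rw [e1, map_smul] at h1
    simp only [zero_add, zero_smul]
    refine (Eq.trans_le ?_ h1).trans_eq ?_
    · change ‖F (projIcc 0 T hT.le s, x + h • e) - F (projIcc 0 T hT.le s, x + 0) - _‖ = _
      rw [add_zero]
      rfl
    · rw [norm_smul, mul_pow, norm_pow]; ring
  exact hO.trans_isLittleO (Asymptotics.isLittleO_pow_id one_lt_two)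

end Slices

/-! ### The energy estimate in `H¹` -/

section Energy

open scoped BoundedContinuousFunction

variable {n m : ℕ} {T : ℝ}

theorem continuous_partialDeriv (j : Fin n) :
    Continuous (H1.partialDeriv j : H1 n m → L2 n m) := by
  unfold H1.partialDeriv
  fun_prop

theorem norm_sq_eq_integral (f : L2 n m) : ‖f‖ ^ 2 = ∫ x, ‖f x‖ ^ 2 := by
  have h := L2.inner_def (𝕜 := ℂ) f f
  rw [inner_self_eq_norm_sq_to_K] at h
  simp only [inner_self_eq_norm_sq_to_K] at h
  have h2 : ((‖f‖ ^ 2 : ℝ) : ℂ) = ((∫ x, ‖f x‖ ^ 2 : ℝ) : ℂ) := by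
    rw [← integral_complex_ofReal]
    simpa using h
  exact_mod_cast h2

theorem hasDerivAt_norm_sq {u : ℝ → L2 n m} {u' : L2 n m} {s : ℝ} (h : HasDerivAt u u' s) :
    HasDerivAt (fun r => ‖u r‖ ^ 2) (2 * (inner ℂ (u s) u').re) s := by
  have h1 := Complex.reCLM.hasFDerivAt.comp_hasDerivAt s (h.inner ℂ h)
  have h2 := inner_re_symm (𝕜 := ℂ) u' (u s)
  simp only [RCLike.re_to_complex] at h2
  refine (h1.congr_deriv ?_).congr_of_eventuallyEq (Filter.Eventually.of_forall fun r => ?_)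
  · simp [h2]; ring
  · simp [inner_self_eq_norm_sq_to_K, ← Complex.ofReal_pow]

theorem energy_estimate_H1 (hT : 0 < T) {A : Fin n → ℝ × Rn n → Mat m} {B : ℝ × Rn n → Mat m}
    (hP : IsSymmetricHyperbolic T A B) (U : ℝ → H1 n m)
    (hU : ContDiffOn ℝ 1 (fun s => H1.toL2 (U s)) (Icc 0 T)) (hU1 : ContinuousOn U (Icc 0 T))
    {t : ℝ} (ht : t ∈ Icc 0 T) :
    ‖H1.toL2 (U t)‖ ^ 2 ≤ Real.exp (∫ s in (0 : ℝ)..t, beta A B s) *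
      (‖H1.toL2 (U 0)‖ ^ 2 + sqNormOmega (opPH1 T A B U) t) := by
  have hdA : ∀ j, DifferentiableOn ℝ (A j) (strip n T) := fun j =>
    differentiableOn_strip (hP.smoothBounded_A j).1
  choose CA hA hA' using fun j => (hP.smoothBounded_A j).exists_boundedLipschitz hT
  obtain ⟨CB, hB, -⟩ := hP.smoothBounded_B.exists_boundedLipschitz hT
  obtain ⟨CZ, hZ⟩ := exists_boundedLipschitz_zeroOrder hT hP
  have hBs : BoundedLipschitz T (fun p => (B p).conjTranspose) CB := hB.conjTranspose
  set u : ℝ → L2 n m := fun s => H1.toL2 (U s) with hu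
  set u' : ℝ → L2 n m := fun s => derivWithin u (Icc 0 T) s with hu'
  -- `V` is `PU` as a curve in `L²`. It agrees with `opPH1` only almost everywhere in `x`, but its
  -- norm is continuous in time, which Gronwall needs.
  set V : ℝ → L2 n m := fun s => u' s
    + ∑ j, mulOp n m (sliceB hT.le (hA j) s) (H1.partialDeriv j (U s))
    + mulOp n m (sliceB hT.le hB s) (u s) with hV
  have hVae : ∀ s ∈ Icc 0 T, ∀ᵐ x, opPH1 T A B U s x = V s x := by
    intro s hs
    have h1 : ∀ᵐ x, ∀ j, mulOp n m (sliceB hT.le (hA j) s) (H1.partialDeriv j (U s)) x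
        = act (A j (s, x)) (H1.partialDeriv j (U s) x) := by
      rw [ae_all_iff]
      intro j
      filter_upwards [coeFn_mulOp (sliceB hT.le (hA j) s) (H1.partialDeriv j (U s))] with x hx
      rw [hx, sliceB_apply _ _ hs]
    filter_upwards [h1, coeFn_mulOp (sliceB hT.le hB s) (u s),
      Lp.coeFn_add (u' s + ∑ j, mulOp n m (sliceB hT.le (hA j) s) (H1.partialDeriv j (U s)))
        (mulOp n m (sliceB hT.le hB s) (u s)),
      Lp.coeFn_add (u' s) (∑ j, mulOp n m (sliceB hT.le (hA j) s) (H1.partialDeriv j (U s))),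
      Lp.coeFn_finsetSum Finset.univ
        (fun j => mulOp n m (sliceB hT.le (hA j) s) (H1.partialDeriv j (U s)))]
      with x a1 a2 a3 a4 a5
    rw [hV, a3, Pi.add_apply, a4, Pi.add_apply, a5, Finset.sum_apply, a2,
      sliceB_apply _ _ hs]
    simp only [a1]
    rfl
  have hslice : ∀ {F : ℝ × Rn n → Mat m} {C : ℝ} (hF : BoundedLipschitz T F C) {w : ℝ → L2 n m},
      ContinuousOn w (Icc 0 T) →
        ContinuousOn (fun s => mulOp n m (sliceB hT.le hF s) (w s)) (Icc 0 T) := fun hF w hw =>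
    ((mulOp n m).continuous.comp (continuous_sliceB hT.le hF)).continuousOn.clm_apply hw
  have hVc : ContinuousOn V (Icc 0 T) :=
    ((hU.continuousOn_derivWithin (uniqueDiffOn_Icc hT) le_rfl).add
      (continuousOn_finsetSum _ fun j _ => hslice (hA j)
        ((continuous_partialDeriv j).comp_continuousOn hU1))).add (hslice hB hU.continuousOn)
  have hβ : ∀ s ∈ Icc 0 T, beta A B s = 1 + ‖sliceB hT.le hZ s‖ := by
    intro s hs
    rw [beta, BoundedContinuousFunction.norm_eq_iSup_norm]
    simp only [sliceB_apply hT.le hZ hs]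
  have hIt : Icc 0 t ⊆ Icc 0 T := Icc_subset_Icc_right ht.2
  have hZeq : ∀ s ∈ Icc 0 T, ∀ f : L2 n m, mulOp n m (sliceB hT.le hZ s) f
      = ∑ j, mulOp n m (sliceB hT.le ((hA' j).clm_apply (0, unitVec j)) s) f
        - mulOp n m (sliceB hT.le hB s) f - mulOp n m (sliceB hT.le hBs s) f := by
    intro s hs f
    have e : sliceB hT.le hZ s = ∑ j, sliceB hT.le ((hA' j).clm_apply (0, unitVec j)) s
        - sliceB hT.le hB s - sliceB hT.le hBs s := by
      refine BoundedContinuousFunction.ext fun x => ?_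
      rw [BoundedContinuousFunction.sub_apply, BoundedContinuousFunction.sub_apply,
        BoundedContinuousFunction.sum_apply]
      simp only [sliceB_apply hT.le _ hs]
      rw [zeroOrder, divA_eq hdA (mem_strip.2 hs)]
    rw [e, map_sub, map_sub, map_sum, sub_apply, sub_apply, sum_apply]
  have hderiv : ∀ s ∈ Ioo 0 T, HasDerivAt u (u' s) s := fun s hs =>
    ((hU.differentiableOn one_ne_zero s (Ioo_subset_Icc_self hs)).hasDerivWithinAt).hasDerivAt
      (Icc_mem_nhds hs.1 hs.2)
  have hbound : ∀ s ∈ Icc 0 T,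
      2 * (inner ℂ (u s) (u' s)).re ≤ (1 + ‖sliceB hT.le hZ s‖) * ‖u s‖ ^ 2 + ‖V s‖ ^ 2 := by
    intro s hs
    have e1 : u' s = V s - ∑ j, mulOp n m (sliceB hT.le (hA j) s) (H1.partialDeriv j (U s))
        - mulOp n m (sliceB hT.le hB s) (u s) := by
      rw [eq_sub_iff_add_eq, eq_sub_iff_add_eq, add_right_comm]
    have e2 : ∀ j, 2 * (inner ℂ (u s) (mulOp n m (sliceB hT.le (hA j) s)
        (H1.partialDeriv j (U s)))).re
        = -(inner ℂ (u s) (mulOp n m (sliceB hT.le ((hA' j).clm_apply (0, unitVec j)) s)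
          (u s))).re := fun j =>
      inner_mulOp_weakPartial ((U s).2 j)
        (hasDerivAt_shiftB_sliceB hT (hdA j) (hA j) (hA' j) s (unitVec j))
        fun x => by
          rw [sliceB_apply _ _ hs]
          exact hP.hermitian j _ (mem_strip.2 hs)
    have e3 : (inner ℂ (u s) (mulOp n m (sliceB hT.le hBs s) (u s))).re
        = (inner ℂ (u s) (mulOp n m (sliceB hT.le hB s) (u s))).re := by
      rw [inner_mulOp_of_conjTranspose (M := sliceB hT.le hB s)
        (fun x => by rw [sliceB_apply _ _ hs, sliceB_apply _ _ hs])]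
      exact inner_re_symm (𝕜 := ℂ) _ _
    -- Integration by parts turns each `-2 Re⟨u, Aʲ∂ⱼu⟩` into `Re⟨u, (∂ⱼAʲ)u⟩`, and `-2 Re⟨u, Bu⟩`
    -- splits evenly between `B` and `B*`; together they form the zeroth order matrix.
    have e4 : 2 * (inner ℂ (u s) (u' s)).re = 2 * (inner ℂ (u s) (V s)).re
        + (inner ℂ (u s) (mulOp n m (sliceB hT.le hZ s) (u s))).re := by
      rw [hZeq s hs, e1]
      simp only [inner_sub_right, inner_sum, Complex.sub_re, Complex.re_sum, mul_sub,
        Finset.mul_sum, e2, e3, Finset.sum_neg_distrib]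
      ring
    have b1 : (inner ℂ (u s) (V s)).re ≤ ‖u s‖ * ‖V s‖ :=
      re_inner_le_norm (𝕜 := ℂ) (u s) (V s)
    have b2 : (inner ℂ (u s) (mulOp n m (sliceB hT.le hZ s) (u s))).re
        ≤ ‖u s‖ * (‖sliceB hT.le hZ s‖ * ‖u s‖) :=
      (re_inner_le_norm (𝕜 := ℂ) (u s) _).trans
        (mul_le_mul_of_nonneg_left (norm_mulOp_le _ _) (norm_nonneg _))
    rw [e4]
    -- The inequality `2‖u‖‖V‖ ≤ ‖u‖² + ‖V‖²` is the source of the summand `1` in `beta`.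
    nlinarith [sq_nonneg (‖u s‖ - ‖V s‖)]
  have hmain := gronwall_le (E := fun s => ‖u s‖ ^ 2)
    (b := fun s => 1 + ‖sliceB hT.le hZ s‖) (N := fun s => ‖V s‖ ^ 2) ht.1
    ((hU.continuousOn.mono hIt).norm.pow 2)
    (continuous_const.add (continuous_sliceB hT.le hZ).norm).continuousOn
    ((hVc.mono hIt).norm.pow 2) (fun s _ => by positivity) (fun s _ => by positivity)
    (fun s hs => ⟨_, hasDerivAt_norm_sq (hderiv s ⟨hs.1, hs.2.trans_le ht.2⟩),
      hbound s (hIt (Ioo_subset_Icc_self hs))⟩)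
  have i1 : ∫ s in (0 : ℝ)..t, beta A B s = ∫ s in (0 : ℝ)..t, (1 + ‖sliceB hT.le hZ s‖) :=
    intervalIntegral.integral_congr fun s hs => hβ s (hIt (by rwa [uIcc_of_le ht.1] at hs))
  have i2 : sqNormOmega (opPH1 T A B U) t = ∫ s in (0 : ℝ)..t, ‖V s‖ ^ 2 := by
    refine intervalIntegral.integral_congr fun s hs => ?_
    rw [uIcc_of_le ht.1] at hs
    simp only [norm_sq_eq_integral (V s)]
    refine integral_congr_ae ?_
    filter_upwards [hVae s (hIt hs)] with x hx
    rw [hx]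
  rw [i1, i2]
  exact hmain

end Energy

/-! ### Geometry of the lens -/

section Lens

open scoped Topology

variable {n : ℕ} {T R₁ R₂ : ℝ}

/-- The height of the lens over `y`, extended by zero. -/
def profile (T R₁ R₂ : ℝ) (y : Rn n) : ℝ := T * max 0 (min 1 ((R₂ - ‖y‖) / (R₂ - R₁)))

theorem profile_nonneg (hT : 0 ≤ T) (y : Rn n) : 0 ≤ profile T R₁ R₂ y :=
  mul_nonneg hT (le_max_left _ _)

theorem profile_le (hT : 0 ≤ T) (y : Rn n) : profile T R₁ R₂ y ≤ T :=
  mul_le_of_le_one_right hT (max_le zero_le_one (min_le_left _ _))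

theorem continuous_profile : Continuous (profile T R₁ R₂ : Rn n → ℝ) := by
  unfold profile
  fun_prop

theorem profile_of_le (hR : R₁ < R₂) {y : Rn n} (hy : ‖y‖ ≤ R₁) : profile T R₁ R₂ y = T := by
  have h : 1 ≤ (R₂ - ‖y‖) / (R₂ - R₁) := by
    rw [one_le_div (by linarith)]; linarith
  rw [profile, min_eq_left h, max_eq_right zero_le_one, mul_one]

theorem profile_of_mem (hR : R₁ < R₂) {y : Rn n} (h1 : R₁ ≤ ‖y‖) (h2 : ‖y‖ ≤ R₂) :
    profile T R₁ R₂ y = T * ((R₂ - ‖y‖) / (R₂ - R₁)) := by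
  have h : (R₂ - ‖y‖) / (R₂ - R₁) ≤ 1 := by
    rw [div_le_one (by linarith)]; linarith
  rw [profile, min_eq_right h, max_eq_right (div_nonneg (by linarith) (by linarith))]

theorem profile_of_ge (hR : R₁ < R₂) {y : Rn n} (h : R₂ ≤ ‖y‖) : profile T R₁ R₂ y = 0 := by
  rw [profile, max_eq_left, mul_zero]
  exact (min_le_right _ _).trans (div_nonpos_of_nonpos_of_nonneg (by linarith) (by linarith))

theorem profile_pos (hT : 0 < T) (hR : R₁ < R₂) {y : Rn n} (h : ‖y‖ < R₂) :
    0 < profile T R₁ R₂ y :=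
  mul_pos hT (lt_max_of_lt_right (lt_min one_pos (div_pos (by linarith) (by linarith))))

theorem exists_lipschitzWith_profile (hT : 0 ≤ T) (hR : R₁ < R₂) :
    ∃ C, LipschitzWith C (profile T R₁ R₂ : Rn n → ℝ) := by
  have h1 : LipschitzWith 1 (fun y : Rn n => ‖y‖) := lipschitzWith_one_norm
  have h2 : LipschitzWith (T * (R₂ - R₁)⁻¹).toNNReal (profile T R₁ R₂ : Rn n → ℝ) := by
    refine LipschitzWith.of_dist_le_mul fun x y => ?_
    have hR' : 0 < R₂ - R₁ := by linarith
    rw [Real.coe_toNNReal _ (by positivity), Real.dist_eq, profile, profile, ← mul_sub, abs_mul,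
      abs_of_nonneg hT, mul_assoc]
    refine mul_le_mul_of_nonneg_left ?_ hT
    have a1 := abs_max_sub_max_le_abs (min 1 ((R₂ - ‖x‖) / (R₂ - R₁)))
      (min 1 ((R₂ - ‖y‖) / (R₂ - R₁))) 0
    have a2 := abs_min_sub_min_le_max 1 ((R₂ - ‖x‖) / (R₂ - R₁)) 1 ((R₂ - ‖y‖) / (R₂ - R₁))
    rw [max_comm _ (0 : ℝ), max_comm _ (0 : ℝ)] at a1
    rw [sub_self, abs_zero, max_eq_right (abs_nonneg _), ← sub_div, abs_div, abs_of_pos hR',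
      sub_sub_sub_cancel_left, div_eq_inv_mul |‖y‖ - ‖x‖|] at a2
    refine a1.trans (a2.trans (mul_le_mul_of_nonneg_left ?_ (by positivity)))
    rw [dist_comm, dist_eq_norm]
    exact abs_norm_sub_norm_le y x
  exact ⟨_, h2⟩

/-- Both branches are the fraction `Θ` of one continuous height function, so the lens becomes a
subgraph over the ball. -/
theorem lensMap_eq (hR : R₁ < R₂) (Θ : ℝ) {y : Rn n} (hy : ‖y‖ ≤ R₂) :
    lensMap T R₁ R₂ Θ y = (Θ * profile T R₁ R₂ y, y) := by
  unfold lensMap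
  split_ifs with h
  · rw [profile_of_le hR h]
  · rw [profile_of_mem hR (not_le.1 h).le hy, mul_assoc]

theorem mem_lens (hT : 0 < T) (hR : R₁ < R₂) {p : ℝ × Rn n} :
    p ∈ lens n T R₁ R₂ ↔ ‖p.2‖ ≤ R₂ ∧ 0 ≤ p.1 ∧ p.1 ≤ profile T R₁ R₂ p.2 := by
  constructor
  · rintro ⟨⟨Θ, y⟩, ⟨hΘ, hy⟩, rfl⟩
    rw [mem_closedBall_zero_iff] at hy
    have h0 := profile_nonneg (R₁ := R₁) (R₂ := R₂) hT.le y
    simp only [lensMap_eq hR Θ hy]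
    exact ⟨hy, mul_nonneg hΘ.1 h0, mul_le_of_le_one_left h0 hΘ.2⟩
  · rintro ⟨h1, h2, h3⟩
    rcases h1.lt_or_eq with h | h
    · have hp := profile_pos (R₁ := R₁) hT hR h
      refine ⟨(p.1 / profile T R₁ R₂ p.2, p.2), ⟨⟨div_nonneg h2 hp.le, (div_le_one hp).2 h3⟩,
        mem_closedBall_zero_iff.2 h1⟩, ?_⟩
      simp only [lensMap_eq hR _ h1, div_mul_cancel₀ _ hp.ne', Prod.mk.eta]
    -- On the rim the height is `0`; every `Θ` gives the same point, and `Θ = 0` is chosen to avoid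
    -- dividing by it.
    · rw [profile_of_ge hR h.ge] at h3
      refine ⟨(0, p.2), ⟨⟨le_rfl, zero_le_one⟩, mem_closedBall_zero_iff.2 h1⟩, ?_⟩
      simp only [lensMap_eq hR _ h1, zero_mul]
      exact Prod.ext (le_antisymm h2 h3) rfl

theorem lens_subset_strip (hT : 0 < T) (hR : R₁ < R₂) : lens n T R₁ R₂ ⊆ strip n T := fun _ hp =>
  have h := (mem_lens hT hR).1 hp
  mem_strip.2 ⟨h.2.1, h.2.2.trans (profile_le hT.le _)⟩

theorem isCompact_lens (hT : 0 < T) (hR : R₁ < R₂) : IsCompact (lens n T R₁ R₂) := by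
  refine IsCompact.of_isClosed_subset
    ((isCompact_Icc (a := (0 : ℝ)) (b := T)).prod (isCompact_closedBall (0 : Rn n) R₂)) ?_ ?_
  · have e : lens n T R₁ R₂
        = {p | ‖p.2‖ ≤ R₂} ∩ ({p | 0 ≤ p.1} ∩ {p | p.1 ≤ profile T R₁ R₂ p.2}) := by
      ext p
      exact mem_lens hT hR
    rw [e]
    exact (isClosed_le (by fun_prop) (by fun_prop)).inter
      ((isClosed_le (by fun_prop) (by fun_prop)).inter
        (isClosed_le continuous_fst (continuous_profile.comp continuous_snd)))
  · intro p hp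
    exact ⟨lens_subset_strip hT hR hp |> mem_strip.1,
      mem_closedBall_zero_iff.2 ((mem_lens hT hR).1 hp).1⟩

theorem mapsTo_profile (hT : 0 ≤ T) {Θ : ℝ} (hΘ : Θ ∈ Icc 0 1) (y : Rn n) :
    (Θ * profile T R₁ R₂ y, y) ∈ strip n T :=
  mem_strip.2 ⟨mul_nonneg hΘ.1 (profile_nonneg hT y),
    (mul_le_of_le_one_left (profile_nonneg hT y) hΘ.2).trans (profile_le hT y)⟩

theorem continuousOn_comp_profile {E : Type*} [TopologicalSpace E] (hT : 0 ≤ T)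
    {F : ℝ × Rn n → E} (hF : ContinuousOn F (strip n T)) :
    ContinuousOn (fun q : ℝ × Rn n => F (q.1 * profile T R₁ R₂ q.2, q.2)) (Icc 0 1 ×ˢ univ) :=
  hF.comp (((continuous_fst.mul (continuous_profile.comp continuous_snd)).prodMk
    continuous_snd).continuousOn) fun q hq => mapsTo_profile hT hq.1 q.2

theorem integrable_comp_profile (hT : 0 ≤ T) {F : ℝ × Rn n → ℝ}
    (hF : ContinuousOn F (strip n T)) {a : ℝ} (ha : a ≤ 1) :
    Integrable (fun q : ℝ × Rn n => F (q.1 * profile T R₁ R₂ q.2, q.2))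
      ((volume.restrict (Ioc 0 a)).prod (volume.restrict (Metric.closedBall 0 R₂))) := by
  rw [Measure.prod_restrict, ← Measure.volume_eq_prod]
  have h : IntegrableOn (fun q : ℝ × Rn n => F (q.1 * profile T R₁ R₂ q.2, q.2))
      (Icc 0 1 ×ˢ Metric.closedBall 0 R₂) volume :=
    ((continuousOn_comp_profile hT hF).mono
      (prod_mono_right (subset_univ _))).integrableOn_compact
      (isCompact_Icc.prod (isCompact_closedBall _ _))
  exact h.mono_set (prod_mono_left (Ioc_subset_Icc_self.trans (Icc_subset_Icc_right ha)))

theorem integrable_profile_mul_comp (hT : 0 ≤ T) {F : ℝ × Rn n → ℝ}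
    (hF : ContinuousOn F (strip n T)) {a : ℝ} (ha : a ≤ 1) :
    Integrable (fun q : ℝ × Rn n => profile T R₁ R₂ q.2 * F (q.1 * profile T R₁ R₂ q.2, q.2))
      ((volume.restrict (Ioc 0 a)).prod (volume.restrict (Metric.closedBall 0 R₂))) := by
  refine (integrable_comp_profile hT hF ha).bdd_mul (c := T) ?_ ?_
  · exact (continuous_profile.comp continuous_snd).aestronglyMeasurable
  · refine Filter.Eventually.of_forall fun q => ?_
    rw [Real.norm_of_nonneg (profile_nonneg hT _)]
    exact profile_le hT _

theorem integrableOn_slice (hT : 0 ≤ T) {F : ℝ × Rn n → ℝ}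
    (hF : ContinuousOn F (strip n T)) {Θ : ℝ} (hΘ : Θ ∈ Icc 0 1) :
    IntegrableOn (fun y : Rn n => F (Θ * profile T R₁ R₂ y, y)) (Metric.closedBall 0 R₂) := by
  refine ContinuousOn.integrableOn_compact (isCompact_closedBall _ _) ?_
  exact (continuousOn_comp_profile hT hF).comp (by fun_prop : Continuous fun y : Rn n =>
    (Θ, y)).continuousOn fun y _ => ⟨hΘ, mem_univ _⟩

/-- Substitution `t = Θ g(y)` on each vertical fibre. The factor `g(y)` is the Jacobian, and the
formula survives on the rim, where both sides vanish. -/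
theorem integral_lens_fiber (hT : 0 < T) (hR : R₁ < R₂) (F : ℝ × Rn n → ℝ) (y : Rn n) :
    ∫ t, (lens n T R₁ R₂).indicator F (t, y)
      = (Metric.closedBall (0 : Rn n) R₂).indicator (fun y => ∫ Θ in (0 : ℝ)..1,
        profile T R₁ R₂ y * F (Θ * profile T R₁ R₂ y, y)) y := by
  by_cases hy : ‖y‖ ≤ R₂
  · rw [indicator_of_mem (mem_closedBall_zero_iff.2 hy), intervalIntegral.integral_const_mul]
    have h2 := intervalIntegral.smul_integral_comp_mul_right (a := 0) (b := 1)
      (fun t => F (t, y)) (profile T R₁ R₂ y)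
    rw [smul_eq_mul, zero_mul, one_mul] at h2
    rw [h2, intervalIntegral.integral_of_le (profile_nonneg hT.le y),
      ← integral_Icc_eq_integral_Ioc, ← integral_indicator measurableSet_Icc]
    refine integral_congr_ae (Filter.Eventually.of_forall fun t => ?_)
    have hiff := mem_lens (p := (t, y)) hT hR
    by_cases ht : t ∈ Icc 0 (profile T R₁ R₂ y)
    · have hl : (t, y) ∈ lens n T R₁ R₂ := hiff.2 ⟨hy, ht⟩
      simp only [indicator_of_mem ht, indicator_of_mem hl]
    · have hl : (t, y) ∉ lens n T R₁ R₂ := fun h => ht (hiff.1 h).2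
      simp only [indicator_of_notMem ht, indicator_of_notMem hl]
  · rw [indicator_of_notMem (fun h => hy (mem_closedBall_zero_iff.1 h))]
    refine integral_eq_zero_of_ae (Filter.Eventually.of_forall fun t => ?_)
    have hl : (t, y) ∉ lens n T R₁ R₂ := fun h => hy ((mem_lens (p := (t, y)) hT hR).1 h).1
    exact indicator_of_notMem hl _

/-- Integration over the lens in the coordinates `(Θ, y)`. -/
theorem integral_lens (hT : 0 < T) (hR : R₁ < R₂) {F : ℝ × Rn n → ℝ}
    (hF : ContinuousOn F (strip n T)) :
    ∫ p in lens n T R₁ R₂, F p = ∫ Θ in (0 : ℝ)..1, ∫ y in Metric.closedBall (0 : Rn n) R₂,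
      profile T R₁ R₂ y * F (Θ * profile T R₁ R₂ y, y) := by
  have hm : MeasurableSet (lens n T R₁ R₂) := (isCompact_lens hT hR).isClosed.measurableSet
  have hi : IntegrableOn F (lens n T R₁ R₂) :=
    (hF.mono (lens_subset_strip hT hR)).integrableOn_compact (isCompact_lens hT hR)
  have hi' : Integrable ((lens n T R₁ R₂).indicator F)
      ((volume : Measure ℝ).prod (volume : Measure (Rn n))) := hi.integrable_indicator hm
  have hc := integrable_profile_mul_comp (R₁ := R₁) (R₂ := R₂) hT.le hF le_rfl
  calc ∫ p in lens n T R₁ R₂, F p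
      = ∫ p, (lens n T R₁ R₂).indicator F p ∂((volume : Measure ℝ).prod
          (volume : Measure (Rn n))) := (integral_indicator hm).symm
    _ = ∫ y, ∫ t, (lens n T R₁ R₂).indicator F (t, y) := integral_prod_symm _ hi'
    _ = ∫ y in Metric.closedBall (0 : Rn n) R₂, ∫ Θ in Ioc (0 : ℝ) 1,
        profile T R₁ R₂ y * F (Θ * profile T R₁ R₂ y, y) := by
      rw [← integral_indicator measurableSet_closedBall]
      simp only [integral_lens_fiber hT hR, intervalIntegral.integral_of_le zero_le_one]
    _ = ∫ Θ in Ioc (0 : ℝ) 1, ∫ y in Metric.closedBall (0 : Rn n) R₂,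
        profile T R₁ R₂ y * F (Θ * profile T R₁ R₂ y, y) :=
      (integral_integral_swap (f := fun (Θ : ℝ) (y : Rn n) =>
        profile T R₁ R₂ y * F (Θ * profile T R₁ R₂ y, y)) hc).symm
    _ = _ := (intervalIntegral.integral_of_le zero_le_one).symm

/-- The partial derivative `∂_j` of the height of the lens, off the edges. -/
def profileDeriv (T R₁ R₂ : ℝ) (j : Fin n) (y : Rn n) : ℝ :=
  if ‖y‖ ≤ R₁ then 0 else -(T / ((R₂ - R₁) * ‖y‖)) * y j

theorem measurable_profileDeriv (j : Fin n) :
    Measurable (profileDeriv T R₁ R₂ j : Rn n → ℝ) := by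
  unfold profileDeriv
  refine Measurable.ite (measurableSet_le (by fun_prop) (by fun_prop)) measurable_const ?_
  have : Measurable fun y : Rn n => y j := (EuclideanSpace.proj (𝕜 := ℝ) j).continuous.measurable
  fun_prop

theorem norm_profileDeriv_le (hT : 0 ≤ T) (hR1 : 0 < R₁) (hR : R₁ < R₂) (j : Fin n) (y : Rn n) :
    ‖profileDeriv T R₁ R₂ j y‖ ≤ T / (R₂ - R₁) := by
  have hR' : 0 < R₂ - R₁ := by linarith
  unfold profileDeriv
  split_ifs with h
  · simp; positivity
  · have hy : 0 < ‖y‖ := hR1.trans (not_le.1 h)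
    rw [norm_mul, norm_neg, Real.norm_of_nonneg (by positivity), ← div_div, div_mul_eq_mul_div,
      div_le_iff₀ hy]
    exact mul_le_mul_of_nonneg_left (PiLp.norm_apply_le y j) (by positivity)

theorem hasFDerivAt_norm_euclidean {y : Rn n} (hy : y ≠ 0) :
    HasFDerivAt (fun z : Rn n => ‖z‖) (‖y‖⁻¹ • innerSL ℝ y) y := by
  have h := (hasStrictFDerivAt_norm_sq y).hasFDerivAt.sqrt (by simpa using hy)
  simp only [Real.sqrt_sq (norm_nonneg _)] at h
  refine h.congr_fderiv ?_
  ext v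
  have : ‖y‖ ≠ 0 := norm_ne_zero_iff.2 hy
  simp
  field_simp

theorem exists_hasFDerivAt_profile (hR1 : 0 < R₁) (hR : R₁ < R₂) {y : Rn n} (h1 : ‖y‖ ≠ R₁)
    (h2 : ‖y‖ < R₂) : ∃ L : Rn n →L[ℝ] ℝ, HasFDerivAt (profile T R₁ R₂) L y ∧
      ∀ j, L (unitVec j) = profileDeriv T R₁ R₂ j y := by
  have hR' : R₂ - R₁ ≠ 0 := by linarith
  rcases lt_or_gt_of_ne h1 with h | h
  · refine ⟨0, ?_, fun j => by simp [profileDeriv, h.le]⟩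
    refine (hasFDerivAt_const T y).congr_of_eventuallyEq ?_
    filter_upwards [(continuous_norm.isOpen_preimage _ isOpen_Iio).mem_nhds h] with z hz
    exact profile_of_le hR (le_of_lt hz)
  · have hy : y ≠ 0 := norm_pos_iff.1 (hR1.trans h)
    refine ⟨T • (R₂ - R₁)⁻¹ • (-(‖y‖⁻¹ • innerSL ℝ y)), ?_, fun j => ?_⟩
    · have hd : HasFDerivAt (fun z : Rn n => T * ((R₂ - R₁)⁻¹ * (R₂ - ‖z‖)))
          (T • (R₂ - R₁)⁻¹ • (-(‖y‖⁻¹ • innerSL ℝ y))) y :=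
        (((hasFDerivAt_norm_euclidean hy).const_sub R₂).const_mul _).const_mul T
      refine hd.congr_of_eventuallyEq ?_
      filter_upwards [(continuous_norm.isOpen_preimage _ (isOpen_Ioo (a := R₁) (b := R₂))).mem_nhds
        ⟨h, h2⟩] with z hz
      rw [profile_of_mem hR hz.1.le hz.2.le, div_eq_inv_mul]
    · have hny : ‖y‖ ≠ 0 := norm_ne_zero_iff.2 hy
      rw [profileDeriv, if_neg (not_le.2 h)]
      simp [EuclideanSpace.inner_single_right]
      field_simp

end Lens

/-! ### The divergence theorem on the lens -/

section Green

open scoped Topology NNReal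

variable {n : ℕ} {T R₁ R₂ : ℝ}

/-- The profile has kinks at both radii, so integration by parts over the ball is done for Lipschitz
functions. Here `W` has bounded derivative on a compact convex cylinder containing the slice. -/
theorem exists_lipschitzOnWith_comp_profile (hT : 0 < T) (hR : R₁ < R₂) {W : ℝ × Rn n → ℝ}
    (hW : ContDiffOn ℝ ∞ W (strip n T)) {Θ : ℝ} (hΘ : Θ ∈ Icc 0 1) :
    ∃ C, LipschitzOnWith C (fun y : Rn n => W (Θ * profile T R₁ R₂ y, y))
      (Metric.closedBall 0 R₂) := by
  have hK : IsCompact (Icc 0 T ×ˢ Metric.closedBall (0 : Rn n) R₂) :=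
    isCompact_Icc.prod (isCompact_closedBall _ _)
  have hsub : Icc 0 T ×ˢ Metric.closedBall (0 : Rn n) R₂ ⊆ strip n T :=
    prod_mono_right (subset_univ _)
  obtain ⟨C, hC⟩ := hK.exists_bound_of_continuousOn
    ((continuousOn_fderivWithin_strip hT hW).mono hsub)
  have h1 : LipschitzOnWith C.toNNReal W (Icc 0 T ×ˢ Metric.closedBall (0 : Rn n) R₂) :=
    Convex.lipschitzOnWith_of_nnnorm_hasFDerivWithin_le (𝕜 := ℝ)
      (fun p hp => ((differentiableOn_strip hW p (hsub hp)).hasFDerivWithinAt).mono hsub)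
      (fun p hp => by
        rw [← NNReal.coe_le_coe, coe_nnnorm]
        exact (hC p hp).trans (Real.le_coe_toNNReal C))
      ((convex_Icc 0 T).prod (convex_closedBall _ _))
  obtain ⟨L, hL⟩ := exists_lipschitzWith_profile (n := n) hT.le hR
  have h2 : LipschitzWith (max (‖Θ‖₊ * L) 1) (fun y : Rn n => (Θ * profile T R₁ R₂ y, y)) :=
    ((lipschitzWith_smul Θ).comp hL).prodMk LipschitzWith.id
  exact ⟨_, h1.comp h2.lipschitzOnWith fun y hy => ⟨mem_strip.1 (mapsTo_profile hT.le hΘ y), hy⟩⟩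

theorem hasFDerivAt_of_mem_Ioo {W : ℝ × Rn n → ℝ} (hW : ContDiffOn ℝ ∞ W (strip n T))
    {p : ℝ × Rn n} (hp : p.1 ∈ Ioo 0 T) :
    HasFDerivAt W (fderivWithin ℝ W (strip n T) p) p :=
  ((differentiableOn_strip hW p (mem_strip.2 (Ioo_subset_Icc_self hp))).hasFDerivWithinAt).hasFDerivAt
    (prod_mem_nhds (Icc_mem_nhds hp.1 hp.2) Filter.univ_mem)

/-- For `0 < Θ < 1` and `‖y‖ < R₂` the point lies at a time in `(0,T)`, where the derivative within
the strip is an ordinary one, and the chain rule applies off the edge. Only values of `w` near `y`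
matter. -/
theorem lineDeriv_comp_profile (hT : 0 < T) (hR1 : 0 < R₁) (hR : R₁ < R₂) {W : ℝ × Rn n → ℝ}
    (hW : ContDiffOn ℝ ∞ W (strip n T)) {Θ : ℝ} (hΘ : Θ ∈ Ioo 0 1) (j : Fin n) {y : Rn n}
    (h1 : ‖y‖ ≠ R₁) (h2 : ‖y‖ < R₂) {w : Rn n → ℝ}
    (hw : EqOn (fun y : Rn n => W (Θ * profile T R₁ R₂ y, y)) w (Metric.closedBall 0 R₂)) :
    lineDeriv ℝ w y (unitVec j)
      = fderivWithin ℝ W (strip n T) (Θ * profile T R₁ R₂ y, y) (0, unitVec j)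
        + Θ * profileDeriv T R₁ R₂ j y
          * fderivWithin ℝ W (strip n T) (Θ * profile T R₁ R₂ y, y) (1, 0) := by
  obtain ⟨L, hL, hLj⟩ := exists_hasFDerivAt_profile (T := T) hR1 hR h1 h2
  have hp := profile_pos (R₁ := R₁) hT hR h2
  have hmem : Θ * profile T R₁ R₂ y ∈ Ioo 0 T :=
    ⟨mul_pos hΘ.1 hp, (mul_lt_of_lt_one_left hp hΘ.2).trans_le (profile_le hT.le y)⟩
  have hd := HasFDerivAt.comp (g := W) (f := fun z : Rn n => (Θ * profile T R₁ R₂ z, z)) y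
    (hasFDerivAt_of_mem_Ioo hW (p := (Θ * profile T R₁ R₂ y, y)) hmem)
    ((hL.const_mul Θ).prodMk (hasFDerivAt_id y))
  have hd' := hd.congr_of_eventuallyEq (f₁ := w) (by
    filter_upwards [(continuous_norm.isOpen_preimage _ isOpen_Iio).mem_nhds h2] with z hz
    exact (hw (mem_closedBall_zero_iff.2 (le_of_lt hz))).symm)
  rw [(hd'.hasLineDerivAt (unitVec j)).lineDeriv]
  have e : ((Θ * profileDeriv T R₁ R₂ j y, unitVec j) : ℝ × Rn n)
      = (0, unitVec j) + (Θ * profileDeriv T R₁ R₂ j y) • (1, 0) := by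
    ext <;> simp
  rw [ContinuousLinearMap.comp_apply, ContinuousLinearMap.prod_apply, smul_apply, hLj,
    ContinuousLinearMap.id_apply, smul_eq_mul, e, map_add, map_smul, smul_eq_mul]

theorem lineDeriv_profile_of_gt (hR : R₁ < R₂) {y : Rn n} (h : R₂ < ‖y‖) (v : Rn n) :
    lineDeriv ℝ (profile T R₁ R₂) y v = 0 := by
  have hd : HasFDerivAt (profile T R₁ R₂) (0 : Rn n →L[ℝ] ℝ) y := by
    refine (hasFDerivAt_const 0 y).congr_of_eventuallyEq ?_
    filter_upwards [(continuous_norm.isOpen_preimage _ isOpen_Ioi).mem_nhds h] with z hz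
    exact profile_of_ge hR (le_of_lt hz)
  rw [(hd.hasLineDerivAt v).lineDeriv, zero_apply]

theorem ae_norm_ne (R : ℝ) (hR : R ≠ 0) : ∀ᵐ y : Rn n, ‖y‖ ≠ R := by
  rw [ae_iff]
  convert! Measure.addHaar_sphere_of_ne_zero (volume : Measure (Rn n)) 0 hR using 2
  ext y
  simp

theorem integrableOn_profileDeriv_mul (hT : 0 ≤ T) (hR1 : 0 < R₁) (hR : R₁ < R₂) (j : Fin n)
    {F : ℝ × Rn n → ℝ} (hF : ContinuousOn F (strip n T)) {Θ : ℝ} (hΘ : Θ ∈ Icc 0 1) :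
    IntegrableOn (fun y : Rn n => profileDeriv T R₁ R₂ j y * F (Θ * profile T R₁ R₂ y, y))
      (Metric.closedBall 0 R₂) :=
  (integrableOn_slice hT hF hΘ).bdd_mul (measurable_profileDeriv j).aestronglyMeasurable
    (Filter.Eventually.of_forall fun y => norm_profileDeriv_le hT hR1 hR j y)

theorem integrableOn_profile_mul (hT : 0 ≤ T) {F : ℝ × Rn n → ℝ}
    (hF : ContinuousOn F (strip n T)) {Θ : ℝ} (hΘ : Θ ∈ Icc 0 1) :
    IntegrableOn (fun y : Rn n => profile T R₁ R₂ y * F (Θ * profile T R₁ R₂ y, y))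
      (Metric.closedBall 0 R₂) :=
  (integrableOn_slice hT hF hΘ).bdd_mul (c := T) continuous_profile.aestronglyMeasurable
    (Filter.Eventually.of_forall fun y => by
      rw [Real.norm_of_nonneg (profile_nonneg hT _)]
      exact profile_le hT _)

/-- The function `W + t ∂_t W`, that is `∂_Θ (Θ W)` in the lens coordinates. -/
def scaledDeriv (T : ℝ) (W : ℝ × Rn n → ℝ) (p : ℝ × Rn n) : ℝ :=
  W p + p.1 * fderivWithin ℝ W (strip n T) p (1, 0)

theorem continuousOn_scaledDeriv (hT : 0 < T) {W : ℝ × Rn n → ℝ}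
    (hW : ContDiffOn ℝ ∞ W (strip n T)) : ContinuousOn (scaledDeriv T W) (strip n T) :=
  hW.continuousOn.add (continuous_fst.continuousOn.mul
    (continuousOn_fderivWithin_apply_strip hT hW (1, 0)))

/-- The integral of `∂_j (g(y) W(Θ g(y), y))` over the ball vanishes. -/
theorem integral_profile_partial_eq_zero (hT : 0 < T) (hR1 : 0 < R₁) (hR : R₁ < R₂)
    {W : ℝ × Rn n → ℝ} (hW : ContDiffOn ℝ ∞ W (strip n T)) {Θ : ℝ} (hΘ : Θ ∈ Ioo 0 1)
    (j : Fin n) :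
    ∫ y in Metric.closedBall (0 : Rn n) R₂,
      (profileDeriv T R₁ R₂ j y * scaledDeriv T W (Θ * profile T R₁ R₂ y, y)
        + profile T R₁ R₂ y
          * fderivWithin ℝ W (strip n T) (Θ * profile T R₁ R₂ y, y) (0, unitVec j)) = 0 := by
  have hΘ' := Ioo_subset_Icc_self hΘ
  obtain ⟨C, hC⟩ := exists_lipschitzOnWith_comp_profile (n := n) hT hR hW hΘ'
  -- A Lipschitz extension to all of `ℝⁿ`; its values off the ball are irrelevant because the
  -- profile vanishes there. The vanishing of the profile on the rim also removes the boundary term.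
  obtain ⟨w, hw, hwe⟩ := hC.extend_real
  obtain ⟨D, hD⟩ := exists_lipschitzWith_profile (n := n) hT.le hR
  have hcs : HasCompactSupport (profile T R₁ R₂ : Rn n → ℝ) :=
    HasCompactSupport.intro (isCompact_closedBall (0 : Rn n) R₂) fun y hy =>
      profile_of_ge hR (not_le.1 fun h => hy (mem_closedBall_zero_iff.2 h)).le
  have hparts := hw.integral_lineDeriv_mul_eq (μ := volume) hD hcs (unitVec j)
  have hae : ∀ᵐ y : Rn n, ‖y‖ ≠ R₁ ∧ ‖y‖ ≠ R₂ :=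
    (ae_norm_ne R₁ hR1.ne').and (ae_norm_ne R₂ (hR1.trans hR).ne')
  have e1 : ∫ y, lineDeriv ℝ w y (unitVec j) * profile T R₁ R₂ y
      = ∫ y in Metric.closedBall (0 : Rn n) R₂,
        (profileDeriv T R₁ R₂ j y * ((Θ * profile T R₁ R₂ y)
            * fderivWithin ℝ W (strip n T) (Θ * profile T R₁ R₂ y, y) (1, 0))
          + profile T R₁ R₂ y
            * fderivWithin ℝ W (strip n T) (Θ * profile T R₁ R₂ y, y) (0, unitVec j)) := by
    rw [← integral_indicator measurableSet_closedBall]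
    refine integral_congr_ae ?_
    filter_upwards [hae] with y hy
    by_cases h : ‖y‖ ≤ R₂
    · rw [indicator_of_mem (mem_closedBall_zero_iff.2 h),
        lineDeriv_comp_profile hT hR1 hR hW hΘ j hy.1 (lt_of_le_of_ne h hy.2) hwe]
      ring
    · rw [indicator_of_notMem (fun h' => h (mem_closedBall_zero_iff.1 h')),
        profile_of_ge hR (not_le.1 h).le, mul_zero]
  have e2 : ∫ y, lineDeriv ℝ (profile T R₁ R₂) y (-unitVec j) * w y
      = -∫ y in Metric.closedBall (0 : Rn n) R₂,
        profileDeriv T R₁ R₂ j y * W (Θ * profile T R₁ R₂ y, y) := by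
    rw [← integral_indicator measurableSet_closedBall, ← integral_neg]
    refine integral_congr_ae ?_
    filter_upwards [hae] with y hy
    by_cases h : ‖y‖ ≤ R₂
    · obtain ⟨L, hL, hLj⟩ := exists_hasFDerivAt_profile (T := T) hR1 hR hy.1
        (lt_of_le_of_ne h hy.2)
      rw [indicator_of_mem (mem_closedBall_zero_iff.2 h),
        (hL.hasLineDerivAt (-unitVec j)).lineDeriv, map_neg, hLj,
        ← hwe (mem_closedBall_zero_iff.2 h), neg_mul]
    · rw [indicator_of_notMem (fun h' => h (mem_closedBall_zero_iff.1 h')),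
        lineDeriv_profile_of_gt hR (not_le.1 h), zero_mul, neg_zero]
  have hc : ContinuousOn (fun p : ℝ × Rn n => p.1 * fderivWithin ℝ W (strip n T) p (1, 0))
      (strip n T) :=
    continuous_fst.continuousOn.mul (continuousOn_fderivWithin_apply_strip hT hW (1, 0))
  have i1 := integrableOn_profileDeriv_mul (R₁ := R₁) (R₂ := R₂) hT.le hR1 hR j hc hΘ'
  have i2 := integrableOn_profile_mul (R₁ := R₁) (R₂ := R₂) hT.le
    (continuousOn_fderivWithin_apply_strip hT hW (0, unitVec j)) hΘ'
  have i3 := integrableOn_profileDeriv_mul (R₁ := R₁) (R₂ := R₂) hT.le hR1 hR j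
    hW.continuousOn hΘ'
  rw [e1, e2] at hparts
  refine Eq.trans ?_ ((integral_add (i1.add i2) i3).trans
    (eq_neg_iff_add_eq_zero.1 (by simpa only [Pi.add_apply] using hparts)))
  refine integral_congr_ae (Filter.Eventually.of_forall fun y => ?_)
  simp only [scaledDeriv, Pi.add_apply]
  ring

theorem hasDerivAt_comp_profile {W : ℝ × Rn n → ℝ} (hT : 0 ≤ T)
    (hW : ContDiffOn ℝ ∞ W (strip n T)) (y : Rn n) {Θ : ℝ} (hΘ : Θ ∈ Ioo 0 1) :
    HasDerivAt (fun s => W (s * profile T R₁ R₂ y, y))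
      (profile T R₁ R₂ y * fderivWithin ℝ W (strip n T) (Θ * profile T R₁ R₂ y, y) (1, 0)) Θ := by
  have hmem := mapsTo_profile (R₁ := R₁) (R₂ := R₂) hT (Ioo_subset_Icc_self hΘ) y
  have h1 : HasDerivWithinAt (fun s : ℝ => (s * profile T R₁ R₂ y, y))
      (profile T R₁ R₂ y, (0 : Rn n)) (Icc 0 1) Θ := by
    have := ((hasDerivAt_id Θ).mul_const (profile T R₁ R₂ y)).prodMk (hasDerivAt_const Θ y)
    rw [one_mul] at this
    exact this.hasDerivWithinAt
  have h2 := HasFDerivWithinAt.comp_hasDerivWithinAt Θ (t := strip n T)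
    ((differentiableOn_strip hW _ hmem).hasFDerivWithinAt) h1
    (fun s hs => mapsTo_profile hT hs y)
  refine (h2.hasDerivAt (Icc_mem_nhds hΘ.1 hΘ.2)).congr_deriv ?_
  have e : ((profile T R₁ R₂ y, 0) : ℝ × Rn n) = profile T R₁ R₂ y • (1, 0) := by
    ext <;> simp
  rw [e, map_smul, smul_eq_mul]

theorem continuousOn_time_comp_profile (hT : 0 ≤ T) {F : ℝ × Rn n → ℝ}
    (hF : ContinuousOn F (strip n T)) (y : Rn n) :
    ContinuousOn (fun Θ => F (Θ * profile T R₁ R₂ y, y)) (Icc 0 1) :=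
  (continuousOn_comp_profile hT hF).comp (by fun_prop : Continuous fun Θ : ℝ =>
    (Θ, y)).continuousOn fun _ hΘ => ⟨hΘ, mem_univ _⟩

variable {V₀ : ℝ × Rn n → ℝ} {V : Fin n → ℝ × Rn n → ℝ}

/-- The flux density of the vector field `(V₀, V)` through the slice with parameter `Θ`, with
respect to `dy`. -/
def fluxDensity (T R₁ R₂ : ℝ) (V₀ : ℝ × Rn n → ℝ) (V : Fin n → ℝ × Rn n → ℝ) (Θ : ℝ)
    (y : Rn n) : ℝ :=
  V₀ (Θ * profile T R₁ R₂ y, y)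
    - Θ * ∑ j, profileDeriv T R₁ R₂ j y * V j (Θ * profile T R₁ R₂ y, y)

/-- Fundamental theorem of calculus in `Θ` for fixed `y`: `∂_Θ (Θ Vⱼ(Θg, y))` is `scaledDeriv` of
`Vⱼ`, and at `Θ = 0` only `V₀` remains. -/
theorem fluxDensity_sub_eq_integral (hT : 0 < T) (h0 : ContDiffOn ℝ ∞ V₀ (strip n T))
    (hV : ∀ j, ContDiffOn ℝ ∞ (V j) (strip n T)) {θ : ℝ} (hθ : θ ∈ Icc 0 1) (y : Rn n) :
    fluxDensity T R₁ R₂ V₀ V θ y - V₀ (0, y)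
      = ∫ Θ in (0 : ℝ)..θ, (profile T R₁ R₂ y
          * fderivWithin ℝ V₀ (strip n T) (Θ * profile T R₁ R₂ y, y) (1, 0)
        - ∑ j, profileDeriv T R₁ R₂ j y * scaledDeriv T (V j) (Θ * profile T R₁ R₂ y, y)) := by
  have hsub : Icc 0 θ ⊆ Icc 0 1 := Icc_subset_Icc_right hθ.2
  have hz : V₀ (0, y) = fluxDensity T R₁ R₂ V₀ V 0 y := by simp [fluxDensity]
  rw [hz]
  symm
  refine intervalIntegral.integral_eq_sub_of_hasDerivAt_of_le
    (f := fun Θ => fluxDensity T R₁ R₂ V₀ V Θ y) hθ.1 ?_ ?_ ?_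
  · unfold fluxDensity
    exact ((continuousOn_time_comp_profile hT.le h0.continuousOn y).sub
      (continuousOn_id.mul (continuousOn_finsetSum _ fun j _ => continuousOn_const.mul
        (continuousOn_time_comp_profile hT.le (hV j).continuousOn y)))).mono hsub
  · intro Θ hΘ
    have hΘ' : Θ ∈ Ioo 0 1 := ⟨hΘ.1, hΘ.2.trans_le hθ.2⟩
    have hs := HasDerivAt.fun_sum (u := Finset.univ) fun j _ =>
      (hasDerivAt_comp_profile (R₁ := R₁) (R₂ := R₂) hT.le (hV j) y hΘ').const_mul
        (profileDeriv T R₁ R₂ j y)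
    refine ((hasDerivAt_comp_profile hT.le h0 y hΘ').sub
      ((hasDerivAt_id Θ).mul hs)).congr_deriv ?_
    simp only [id, one_mul, Finset.mul_sum, scaledDeriv, ← Finset.sum_add_distrib]
    congr 1
    refine Finset.sum_congr rfl fun j _ => ?_
    ring
  · refine ContinuousOn.intervalIntegrable_of_Icc hθ.1 (ContinuousOn.mono ?_ hsub)
    exact (continuousOn_const.mul (continuousOn_time_comp_profile hT.le
      (continuousOn_fderivWithin_apply_strip hT h0 (1, 0)) y)).sub
      (continuousOn_finsetSum _ fun j _ => continuousOn_const.mul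
        (continuousOn_time_comp_profile hT.le (continuousOn_scaledDeriv hT (hV j)) y))

/-- The space-time divergence of the vector field `(V₀, V)`. -/
def spaceTimeDiv (T : ℝ) (V₀ : ℝ × Rn n → ℝ) (V : Fin n → ℝ × Rn n → ℝ) (p : ℝ × Rn n) : ℝ :=
  fderivWithin ℝ V₀ (strip n T) p (1, 0)
    + ∑ j, fderivWithin ℝ (V j) (strip n T) p (0, unitVec j)

theorem continuousOn_spaceTimeDiv (hT : 0 < T) (h0 : ContDiffOn ℝ ∞ V₀ (strip n T))
    (hV : ∀ j, ContDiffOn ℝ ∞ (V j) (strip n T)) :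
    ContinuousOn (spaceTimeDiv T V₀ V) (strip n T) :=
  (continuousOn_fderivWithin_apply_strip hT h0 _).add (continuousOn_finsetSum _ fun j _ =>
    continuousOn_fderivWithin_apply_strip hT (hV j) _)

theorem integrableOn_fluxDensity (hT : 0 < T) (hR1 : 0 < R₁) (hR : R₁ < R₂)
    (h0 : ContDiffOn ℝ ∞ V₀ (strip n T)) (hV : ∀ j, ContDiffOn ℝ ∞ (V j) (strip n T)) {θ : ℝ}
    (hθ : θ ∈ Icc 0 1) :
    IntegrableOn (fluxDensity T R₁ R₂ V₀ V θ) (Metric.closedBall (0 : Rn n) R₂) :=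
  (integrableOn_slice hT.le h0.continuousOn hθ).sub (Integrable.const_mul
    (integrable_finsetSum _ fun j _ =>
      integrableOn_profileDeriv_mul hT.le hR1 hR j (hV j).continuousOn hθ) θ)

/-- The integrands differ by `∑ⱼ ∂ⱼ(g(y) Vⱼ(Θ g(y), y))`, each summand of which integrates to zero
over the ball. -/
theorem integral_slice_deriv_eq (hT : 0 < T) (hR1 : 0 < R₁) (hR : R₁ < R₂)
    (h0 : ContDiffOn ℝ ∞ V₀ (strip n T)) (hV : ∀ j, ContDiffOn ℝ ∞ (V j) (strip n T)) {Θ : ℝ}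
    (hΘ : Θ ∈ Ioo 0 1) :
    ∫ y in Metric.closedBall (0 : Rn n) R₂, (profile T R₁ R₂ y
          * fderivWithin ℝ V₀ (strip n T) (Θ * profile T R₁ R₂ y, y) (1, 0)
        - ∑ j, profileDeriv T R₁ R₂ j y * scaledDeriv T (V j) (Θ * profile T R₁ R₂ y, y))
      = ∫ y in Metric.closedBall (0 : Rn n) R₂,
        profile T R₁ R₂ y * spaceTimeDiv T V₀ V (Θ * profile T R₁ R₂ y, y) := by
  have hΘ' := Ioo_subset_Icc_self hΘ
  have hz := fun j => integral_profile_partial_eq_zero hT hR1 hR (hV j) hΘ j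
  have i1 := integrableOn_profile_mul (R₁ := R₁) (R₂ := R₂) hT.le
    (continuousOn_spaceTimeDiv hT h0 hV) hΘ'
  have i2 := fun j => (integrableOn_profileDeriv_mul (R₁ := R₁) (R₂ := R₂) hT.le hR1 hR j
    (continuousOn_scaledDeriv hT (hV j)) hΘ').add
    (integrableOn_profile_mul (R₁ := R₁) (R₂ := R₂) hT.le
      (continuousOn_fderivWithin_apply_strip hT (hV j) (0, unitVec j)) hΘ')
  have hs := integral_sub i1 (integrable_finsetSum Finset.univ fun j _ => i2 j)
  rw [integral_finsetSum _ fun j _ => i2 j] at hs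
  simp only [Pi.add_apply, hz, Finset.sum_const_zero, sub_zero] at hs
  rw [← hs]
  refine integral_congr_ae (Filter.Eventually.of_forall fun y => ?_)
  simp only [spaceTimeDiv, mul_add, Finset.sum_add_distrib, Finset.mul_sum]
  ring

/-- The divergence theorem on the part of the lens below the slice with parameter `θ`. -/
theorem integral_fluxDensity_sub (hT : 0 < T) (hR1 : 0 < R₁) (hR : R₁ < R₂)
    (h0 : ContDiffOn ℝ ∞ V₀ (strip n T)) (hV : ∀ j, ContDiffOn ℝ ∞ (V j) (strip n T)) {θ : ℝ}
    (hθ : θ ∈ Icc 0 1) :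
    (∫ y in Metric.closedBall (0 : Rn n) R₂, fluxDensity T R₁ R₂ V₀ V θ y)
        - ∫ y in Metric.closedBall (0 : Rn n) R₂, V₀ (0, y)
      = ∫ Θ in (0 : ℝ)..θ, ∫ y in Metric.closedBall (0 : Rn n) R₂,
        profile T R₁ R₂ y * spaceTimeDiv T V₀ V (Θ * profile T R₁ R₂ y, y) := by
  have i0 : IntegrableOn (fun y : Rn n => V₀ (0, y)) (Metric.closedBall 0 R₂) := by
    simpa using integrableOn_slice (R₁ := R₁) (R₂ := R₂) hT.le h0.continuousOn
      (left_mem_Icc.2 zero_le_one)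
  have hint : Integrable (fun q : ℝ × Rn n => profile T R₁ R₂ q.2
          * fderivWithin ℝ V₀ (strip n T) (q.1 * profile T R₁ R₂ q.2, q.2) (1, 0)
        - ∑ j, profileDeriv T R₁ R₂ j q.2
          * scaledDeriv T (V j) (q.1 * profile T R₁ R₂ q.2, q.2))
      ((volume.restrict (Ioc 0 θ)).prod (volume.restrict (Metric.closedBall 0 R₂))) := by
    refine (integrable_profile_mul_comp hT.le
      (continuousOn_fderivWithin_apply_strip hT h0 (1, 0)) hθ.2).sub
      (integrable_finsetSum _ fun j _ => ?_)
    exact (integrable_comp_profile hT.le (continuousOn_scaledDeriv hT (hV j)) hθ.2).bdd_mul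
      ((measurable_profileDeriv j).comp measurable_snd).aestronglyMeasurable
      (Filter.Eventually.of_forall fun q => norm_profileDeriv_le hT.le hR1 hR j q.2)
  rw [← integral_sub (integrableOn_fluxDensity hT hR1 hR h0 hV hθ) i0]
  simp only [fluxDensity_sub_eq_integral hT h0 hV hθ, intervalIntegral.integral_of_le hθ.1]
  -- Fubini; the endpoints are then discarded as a null set, because the slice identity is available
  -- only for `0 < Θ < 1`.
  rw [← integral_integral_swap (f := fun (Θ : ℝ) (y : Rn n) => profile T R₁ R₂ y
          * fderivWithin ℝ V₀ (strip n T) (Θ * profile T R₁ R₂ y, y) (1, 0)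
        - ∑ j, profileDeriv T R₁ R₂ j y
          * scaledDeriv T (V j) (Θ * profile T R₁ R₂ y, y)) hint,
    integral_Ioc_eq_integral_Ioo, integral_Ioc_eq_integral_Ioo]
  exact setIntegral_congr_fun measurableSet_Ioo fun Θ hΘ =>
    integral_slice_deriv_eq hT hR1 hR h0 hV ⟨hΘ.1, hΘ.2.trans_le hθ.2⟩

end Green

/-! ### The energy identity and the estimate on the lens -/

section LensEstimate

variable {n m : ℕ} {T R₁ R₂ : ℝ} {A : Fin n → ℝ × Rn n → Mat m} {B : ℝ × Rn n → Mat m}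
  {U : ℝ × Rn n → Cm m}

/-- The energy density `|U|²`. -/
def energyDensity (U : ℝ × Rn n → Cm m) (p : ℝ × Rn n) : ℝ := ‖U p‖ ^ 2

/-- The energy flux `Re ⟨U, Aʲ U⟩`. -/
def energyFlux (A : Fin n → ℝ × Rn n → Mat m) (U : ℝ × Rn n → Cm m) (j : Fin n)
    (p : ℝ × Rn n) : ℝ :=
  (inner ℂ (U p) (act (A j p) (U p))).re

theorem contDiffOn_energyDensity (hU : ContDiffOn ℝ ∞ U (strip n T)) :
    ContDiffOn ℝ ∞ (energyDensity U) (strip n T) :=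
  hU.norm_sq ℂ

theorem contDiffOn_act {M : ℝ × Rn n → Mat m} (hM : ContDiffOn ℝ ∞ M (strip n T))
    (hU : ContDiffOn ℝ ∞ U (strip n T)) :
    ContDiffOn ℝ ∞ (fun p => act (M p) (U p)) (strip n T) :=
  ((actL m).contDiff.comp_contDiffOn hM).clm_apply hU

theorem contDiffOn_energyFlux {j : Fin n} (hA : ContDiffOn ℝ ∞ (A j) (strip n T))
    (hU : ContDiffOn ℝ ∞ U (strip n T)) : ContDiffOn ℝ ∞ (energyFlux A U j) (strip n T) :=
  Complex.reCLM.contDiff.comp_contDiffOn (hU.inner ℂ (contDiffOn_act hA hU))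

theorem re_inner_comm (v w : Cm m) : (inner ℂ v w).re = (inner ℂ w v).re :=
  inner_re_symm (𝕜 := ℂ) v w

theorem fderivWithin_energyDensity (hT : 0 < T) (hU : ContDiffOn ℝ ∞ U (strip n T))
    {p : ℝ × Rn n} (hp : p ∈ strip n T) (v : ℝ × Rn n) :
    fderivWithin ℝ (energyDensity U) (strip n T) p v
      = 2 * (inner ℂ (U p) (fderivWithin ℝ U (strip n T) p v)).re := by
  have hd := (differentiableOn_strip hU p hp).hasFDerivWithinAt
  have h := Complex.reCLM.hasFDerivAt.comp_hasFDerivWithinAt p (hd.inner ℂ hd)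
  have e : energyDensity U = Complex.reCLM ∘ fun q => inner ℂ (U q) (U q) := by
    funext q
    simp [energyDensity, inner_self_eq_norm_sq_to_K, ← Complex.ofReal_pow]
  rw [e, h.fderivWithin (uniqueDiffOn_strip n hT p hp)]
  simp [fderivInnerCLM_apply, re_inner_comm (fderivWithin ℝ U (strip n T) p v) (U p)]
  ring

/-- Hermitian symmetry of `Aʲ` merges the two terms in which `U` is differentiated. -/
theorem fderivWithin_energyFlux (hT : 0 < T) {j : Fin n}
    (hA : ContDiffOn ℝ ∞ (A j) (strip n T)) (hH : ∀ p ∈ strip n T, (A j p).IsHermitian)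
    (hU : ContDiffOn ℝ ∞ U (strip n T)) {p : ℝ × Rn n} (hp : p ∈ strip n T) (v : ℝ × Rn n) :
    fderivWithin ℝ (energyFlux A U j) (strip n T) p v
      = 2 * (inner ℂ (U p) (act (A j p) (fderivWithin ℝ U (strip n T) p v))).re
        + (inner ℂ (U p) (act (fderivWithin ℝ (A j) (strip n T) p v) (U p))).re := by
  have hd := (differentiableOn_strip hU p hp).hasFDerivWithinAt
  have hdA := (differentiableOn_strip hA p hp).hasFDerivWithinAt
  have hAU := (actL m).hasFDerivWithinAt_of_bilinear hdA hd
  have h := Complex.reCLM.hasFDerivAt.comp_hasFDerivWithinAt p (hd.inner ℂ hAU)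
  have e : energyFlux A U j = Complex.reCLM ∘ fun q => inner ℂ (U q) (actL m (A j q) (U q)) := rfl
  rw [e, h.fderivWithin (uniqueDiffOn_strip n hT p hp)]
  have h1 : (inner ℂ (fderivWithin ℝ U (strip n T) p v) (act (A j p) (U p))).re
      = (inner ℂ (U p) (act (A j p) (fderivWithin ℝ U (strip n T) p v))).re := by
    rw [inner_act_of_isHermitian (hH p hp), re_inner_comm]
  simp only [ContinuousLinearMap.comp_apply, ContinuousLinearMap.prod_apply,
    fderivInnerCLM_apply, Complex.reCLM_apply, add_apply, Complex.add_re, inner_add_right,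
    ContinuousLinearMap.precompR_apply, ContinuousLinearMap.compL_apply,
    ContinuousLinearMap.precompL_apply, actL_apply, h1]
  ring

/-- The energy identity: the divergence of the energy current. -/
theorem spaceTimeDiv_energy (hT : 0 < T) (hP : IsSymmetricHyperbolic T A B)
    (hU : ContDiffOn ℝ ∞ U (strip n T)) {p : ℝ × Rn n} (hp : p ∈ strip n T) :
    spaceTimeDiv T (energyDensity U) (energyFlux A U) p
      = 2 * (inner ℂ (U p) (opP T A B U p)).re
        + (inner ℂ (U p) (act (zeroOrder A B p) (U p))).re := by
  -- With equal real parts, the `-B - B*` in `zeroOrder` cancels the contribution of `B` to `2 Re⟨U,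
  -- PU⟩`.
  have hB : (inner ℂ (U p) (act (B p).conjTranspose (U p))).re
      = (inner ℂ (U p) (act (B p) (U p))).re := by
    rw [inner_act_conjTranspose, re_inner_comm]
  have hZ : act (zeroOrder A B p) (U p)
      = ∑ j, act (fderivWithin ℝ (A j) (strip n T) p (0, unitVec j)) (U p)
        - act (B p) (U p) - act (B p).conjTranspose (U p) := by
    rw [zeroOrder, divA_eq (fun j => differentiableOn_strip (hP.smoothBounded_A j).1) hp]
    simp only [← actL_apply, map_sub, map_sum, sub_apply, sum_apply]
  rw [spaceTimeDiv, fderivWithin_energyDensity hT hU hp, opP_eq hT A B (differentiableOn_strip hU) hp,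
    hZ]
  simp only [fun j => fderivWithin_energyFlux hT (hP.smoothBounded_A j).1 (hP.hermitian j) hU hp
    (0, unitVec j), inner_add_right, inner_sub_right, inner_sum, Complex.add_re, Complex.sub_re,
    Complex.re_sum, hB, Finset.sum_add_distrib, Finset.mul_sum, mul_add]
  ring

theorem continuousOn_opP (hT : 0 < T) (hP : IsSymmetricHyperbolic T A B)
    (hU : ContDiffOn ℝ ∞ U (strip n T)) : ContinuousOn (opP T A B U) (strip n T) := by
  have h : ∀ {M : ℝ × Rn n → Mat m} {w : ℝ × Rn n → Cm m}, ContDiffOn ℝ ∞ M (strip n T) →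
      ContinuousOn w (strip n T) → ContinuousOn (fun p => actL m (M p) (w p)) (strip n T) :=
    fun hM hw => ((actL m).continuous.comp_continuousOn hM.continuousOn).clm_apply hw
  exact (((continuousOn_fderivWithin_apply_strip hT hU (1, 0)).add
    (continuousOn_finsetSum _ fun j _ => h (hP.smoothBounded_A j).1
      (continuousOn_fderivWithin_apply_strip hT hU (0, unitVec j)))).add
    (h hP.smoothBounded_B.1 hU.continuousOn)).congr fun p hp =>
      opP_eq hT A B (differentiableOn_strip hU) hp

theorem one_le_alphaLens : 1 ≤ alphaLens A B T R₁ R₂ :=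
  le_add_of_nonneg_right (Real.iSup_nonneg fun _ => norm_nonneg _)

theorem spaceTimeDiv_energy_le (hT : 0 < T) (hR : R₁ < R₂) (hP : IsSymmetricHyperbolic T A B)
    (hU : ContDiffOn ℝ ∞ U (strip n T)) {p : ℝ × Rn n} (hp : p ∈ lens n T R₁ R₂) :
    spaceTimeDiv T (energyDensity U) (energyFlux A U) p
      ≤ alphaLens A B T R₁ R₂ * ‖U p‖ ^ 2 + ‖opP T A B U p‖ ^ 2 := by
  have hps := lens_subset_strip hT hR hp
  obtain ⟨C, hC⟩ := exists_boundedLipschitz_zeroOrder hT hP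
  have hZ : ‖zeroOrder A B p‖ ≤ ⨆ q : lens n T R₁ R₂, ‖zeroOrder A B q‖ :=
    le_ciSup (f := fun q : lens n T R₁ R₂ => ‖zeroOrder A B q‖)
      ⟨C, by rintro _ ⟨q, rfl⟩; exact hC.bound _ (lens_subset_strip hT hR q.2)⟩ ⟨p, hp⟩
  rw [spaceTimeDiv_energy hT hP hU hps, alphaLens]
  have b1 : (inner ℂ (U p) (opP T A B U p)).re ≤ ‖U p‖ * ‖opP T A B U p‖ :=
    re_inner_le_norm (𝕜 := ℂ) _ _
  have b2 : (inner ℂ (U p) (act (zeroOrder A B p) (U p))).re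
      ≤ ‖U p‖ * (‖zeroOrder A B p‖ * ‖U p‖) :=
    (re_inner_le_norm (𝕜 := ℂ) _ _).trans
      (mul_le_mul_of_nonneg_left (norm_act_le _ _) (norm_nonneg _))
  nlinarith [sq_nonneg (‖U p‖ - ‖opP T A B U p‖), mul_le_mul_of_nonneg_right hZ (sq_nonneg ‖U p‖)]

theorem profile_point_mem_lens (hT : 0 < T) (hR : R₁ < R₂) {Θ : ℝ} (hΘ : Θ ∈ Icc 0 1) {y : Rn n}
    (hy : y ∈ Metric.closedBall 0 R₂) : (Θ * profile T R₁ R₂ y, y) ∈ lens n T R₁ R₂ :=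
  (mem_lens hT hR).2 ⟨mem_closedBall_zero_iff.1 hy, mul_nonneg hΘ.1 (profile_nonneg hT.le y),
    mul_le_of_le_one_left (profile_nonneg hT.le y) hΘ.2⟩

/-- The spacelike condition bounds the energy flux through a slice from below. -/
theorem half_energyDensity_le_fluxDensity (hT : 0 < T) (hR1 : 0 < R₁) (hR : R₁ < R₂)
    (hS : IsSpacelikeLens A T R₁ R₂) {Θ : ℝ} (hΘ : Θ ∈ Ioc 0 1) {y : Rn n} (h1 : ‖y‖ ≠ R₁)
    (h2 : ‖y‖ < R₂) :
    1 / 2 * energyDensity U (Θ * profile T R₁ R₂ y, y)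
      ≤ fluxDensity T R₁ R₂ (energyDensity U) (energyFlux A U) Θ y := by
  set p : ℝ × Rn n := (Θ * profile T R₁ R₂ y, y) with hp
  have h := hS Θ hΘ p ⟨y, mem_closedBall_zero_iff.2 h2.le, lensMap_eq hR Θ h2.le⟩ h1 h2 (U p)
  rcases lt_or_gt_of_ne h1 with hy | hy
  · have e : fluxDensity T R₁ R₂ (energyDensity U) (energyFlux A U) Θ y = energyDensity U p := by
      simp [fluxDensity, profileDeriv, hy.le, hp]
    rw [e]
    have : 0 ≤ energyDensity U p := sq_nonneg _
    linarith
  · have hR' : 0 < R₂ - R₁ := by linarith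
    have hy0 : 0 < ‖y‖ := hR1.trans hy
    set S := √((Θ * T) ^ 2 + (R₂ - R₁) ^ 2)
    have hS1 : R₂ - R₁ ≤ S := Real.le_sqrt_of_sq_le (by nlinarith [sq_nonneg (Θ * T)])
    have hS0 : 0 < S := hR'.trans_le hS1
    set ν := (R₂ - R₁) / S with hν
    have hν0 : 0 < ν := div_pos hR' hS0
    have hν1 : ν ≤ 1 := (div_le_one hS0).2 hS1
    have hn : lensNormal T R₁ R₂ Θ p.2 = (ν, (Θ * T / (S * ‖y‖)) • y) := by
      rw [lensNormal, if_neg (not_le.2 hy)]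
    -- On the cone, `ν(1, -Θ∇g)` is exactly the unit normal, so the quadratic form of the symbol is
    -- `ν` times the flux density; `1/ν` is the area element of the slice over `dy`.
    have hq : (inner ℂ (U p) (act (symbol A p (lensNormal T R₁ R₂ Θ p.2)) (U p))).re
        = ν * fluxDensity T R₁ R₂ (energyDensity U) (energyFlux A U) Θ y := by
      rw [hn, symbol]
      simp only [← actL_apply, map_add, map_sum, add_apply, sum_apply, inner_add_right, inner_sum,
        Complex.add_re, Complex.re_sum]
      simp only [Complex.coe_smul, map_smul, smul_apply, inner_smul_right_eq_smul,
        Complex.smul_re, smul_eq_mul]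
      rw [fluxDensity, mul_sub, sub_eq_add_neg]
      congr 1
      · congr 1
        rw [actL_apply, act, map_one, one_apply_eq_self, energyDensity]
        exact inner_self_eq_norm_sq (𝕜 := ℂ) (U p)
      · rw [Finset.mul_sum, Finset.mul_sum, ← Finset.sum_neg_distrib]
        refine Finset.sum_congr rfl fun j _ => ?_
        rw [energyFlux, profileDeriv, if_neg (not_le.2 hy), PiLp.smul_apply, smul_eq_mul, hν]
        rw [actL_apply, hp]
        field_simp
    rw [hq] at h
    have hE : 0 ≤ energyDensity U p := sq_nonneg _
    have hE' : energyDensity U p = ‖U p‖ ^ 2 := rfl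
    rw [← hE'] at h
    -- Nonnegativity of the flux is needed first, so that `ν ≤ 1` allows `ν` to be dropped from
    -- `½|U|² ≤ ν · flux`.
    have hF : 0 ≤ fluxDensity T R₁ R₂ (energyDensity U) (energyFlux A U) Θ y := by
      by_contra hneg
      have := mul_neg_of_pos_of_neg hν0 (not_le.1 hneg)
      linarith
    nlinarith [mul_le_of_le_one_left hF hν1]

theorem sqNormInitial_eq (hR : R₁ < R₂) (U : ℝ × Rn n → Cm m) :
    sqNormInitial T R₁ R₂ U
      = ∫ y in Metric.closedBall (0 : Rn n) R₂, energyDensity U (0, y) := by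
  have e : {x : Rn n | ((0 : ℝ), x) ∈ lensSlice n T R₁ R₂ 0} = Metric.closedBall 0 R₂ := by
    ext x
    constructor
    · rintro ⟨y, hy, h⟩
      rw [lensMap_eq hR 0 (mem_closedBall_zero_iff.1 hy)] at h
      have hx : y = x := (Prod.ext_iff.1 h).2
      rwa [← hx]
    · intro hx
      refine ⟨x, hx, ?_⟩
      rw [lensMap_eq hR 0 (mem_closedBall_zero_iff.1 hx), zero_mul]
  rw [sqNormInitial, e]
  rfl

/-- The slice integrals depend continuously on the parameter. -/
theorem continuousOn_integral_profile_mul (hT : 0 ≤ T) {F : ℝ × Rn n → ℝ}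
    (hF : ContinuousOn F (strip n T)) :
    ContinuousOn (fun Θ : ℝ => ∫ y in Metric.closedBall (0 : Rn n) R₂,
      profile T R₁ R₂ y * F (Θ * profile T R₁ R₂ y, y)) (Icc 0 1) := by
  -- Clamping `Θ` to `[0,1]` makes the integrand continuous for all parameters without changing it
  -- on the interval.
  have hc : Continuous (Function.uncurry fun (Θ : ℝ) (y : Rn n) => profile T R₁ R₂ y
      * F ((projIcc 0 1 zero_le_one Θ : ℝ) * profile T R₁ R₂ y, y)) := by
    refine (continuous_profile.comp continuous_snd).mul ?_
    refine (continuousOn_comp_profile hT hF).comp_continuous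
      (f := fun q : ℝ × Rn n => ((projIcc 0 1 zero_le_one q.1 : ℝ), q.2)) (by fun_prop) fun q =>
      ⟨(projIcc 0 1 zero_le_one q.1).2, mem_univ _⟩
  refine (continuous_parametric_integral_of_continuous (μ := volume) hc
    (isCompact_closedBall (0 : Rn n) R₂)).continuousOn.congr fun Θ hΘ => ?_
  simp only [projIcc_of_mem zero_le_one hΘ]

/-- Gronwall is applied to the accumulated mass `τ ↦ ∫₀^τ J |U|²` rather than to the energy of a
slice: its derivative is controlled by the flux, and its value at `1` is the norm to be estimated.
-/
theorem energy_estimate_lens (hT : 0 < T) (hP : IsSymmetricHyperbolic T A B) (hR1 : 0 < R₁)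
    (hR : R₁ < R₂) (hS : IsSpacelikeLens A T R₁ R₂) (hU : ContDiffOn ℝ ∞ U (strip n T)) :
    sqNormLens T R₁ R₂ U ≤ 2 * T * Real.exp (2 * T * alphaLens A B T R₁ R₂) *
      (sqNormInitial T R₁ R₂ U + sqNormLens T R₁ R₂ (opP T A B U)) := by
  have hE := contDiffOn_energyDensity hU
  have hV := fun j => contDiffOn_energyFlux (hP.smoothBounded_A j).1 hU
  set α := alphaLens A B T R₁ R₂ with hα
  have hα1 : 1 ≤ α := one_le_alphaLens
  set Q : ℝ × Rn n → ℝ := energyDensity (opP T A B U) with hQ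
  have hQc : ContinuousOn Q (strip n T) := (continuousOn_opP hT hP hU).norm.pow 2
  have hQ0 : ∀ p, 0 ≤ Q p := fun p => sq_nonneg _
  set K := Metric.closedBall (0 : Rn n) R₂ with hK
  let J : (ℝ × Rn n → ℝ) → ℝ → ℝ := fun F Θ =>
    ∫ y in K, profile T R₁ R₂ y * F (Θ * profile T R₁ R₂ y, y)
  have hJc : ∀ {F : ℝ × Rn n → ℝ}, ContinuousOn F (strip n T) → ContinuousOn (J F) (Icc 0 1) :=
    fun hF => continuousOn_integral_profile_mul hT.le hF
  have hJi : ∀ {F : ℝ × Rn n → ℝ}, ContinuousOn F (strip n T) → ∀ {τ : ℝ}, τ ∈ Icc 0 1 →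
      IntervalIntegrable (J F) volume 0 τ := fun hF τ hτ =>
    ((hJc hF).mono (Icc_subset_Icc_right hτ.2)).intervalIntegrable_of_Icc hτ.1
  have hJ0 : ∀ {F : ℝ × Rn n → ℝ}, (∀ p, 0 ≤ F p) → ∀ Θ, 0 ≤ J F Θ := fun hF Θ =>
    integral_nonneg fun y => mul_nonneg (profile_nonneg hT.le y) (hF _)
  set D := sqNormInitial T R₁ R₂ U + sqNormLens T R₁ R₂ (opP T A B U) with hD
  have hLU : sqNormLens T R₁ R₂ U = ∫ Θ in (0 : ℝ)..1, J (energyDensity U) Θ :=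
    integral_lens hT hR hE.continuousOn
  have hLP : sqNormLens T R₁ R₂ (opP T A B U) = ∫ Θ in (0 : ℝ)..1, J Q Θ :=
    integral_lens hT hR hQc
  have hD0 : 0 ≤ D := by
    rw [hD, sqNormInitial_eq hR, sqNormLens]
    exact add_nonneg (integral_nonneg fun _ => sq_nonneg _) (integral_nonneg fun _ => sq_nonneg _)
  have hflux : ∀ τ ∈ Icc (0 : ℝ) 1,
      ∫ y in K, fluxDensity T R₁ R₂ (energyDensity U) (energyFlux A U) τ y
        ≤ D + α * ∫ Θ in (0 : ℝ)..τ, J (energyDensity U) Θ := by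
    intro τ hτ
    have hg := integral_fluxDensity_sub hT hR1 hR hE hV hτ
    have hdc := continuousOn_spaceTimeDiv hT hE hV
    have h1 : ∫ Θ in (0 : ℝ)..τ, J (spaceTimeDiv T (energyDensity U) (energyFlux A U)) Θ
        ≤ ∫ Θ in (0 : ℝ)..τ, (α * J (energyDensity U) Θ + J Q Θ) := by
      refine intervalIntegral.integral_mono_on hτ.1 (hJi hdc hτ)
        (((hJi hE.continuousOn hτ).const_mul α).add (hJi hQc hτ)) fun Θ hΘ => ?_
      have hΘ' : Θ ∈ Icc (0 : ℝ) 1 := ⟨hΘ.1, hΘ.2.trans hτ.2⟩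
      have iE := integrableOn_profile_mul (R₁ := R₁) (R₂ := R₂) hT.le hE.continuousOn hΘ'
      have iQ := integrableOn_profile_mul (R₁ := R₁) (R₂ := R₂) hT.le hQc hΘ'
      have hadd := integral_add (iE.const_mul α) iQ
      rw [integral_const_mul] at hadd
      refine le_trans (setIntegral_mono_on (integrableOn_profile_mul hT.le hdc hΘ')
        ((iE.const_mul α).add iQ)
        measurableSet_closedBall fun y hy => ?_) hadd.le
      have := mul_le_mul_of_nonneg_left (spaceTimeDiv_energy_le hT hR hP hU
        (profile_point_mem_lens hT hR hΘ' hy)) (profile_nonneg (R₁ := R₁) (R₂ := R₂) hT.le y)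
      refine this.trans_eq ?_
      simp only [energyDensity, hQ, hα, Pi.add_apply]
      ring
    rw [intervalIntegral.integral_add ((hJi hE.continuousOn hτ).const_mul α) (hJi hQc hτ),
      intervalIntegral.integral_const_mul] at h1
    -- Enlarging the source integral to the whole lens makes the inhomogeneous term `D` independent
    -- of `τ`.
    have h2 : ∫ Θ in (0 : ℝ)..τ, J Q Θ ≤ ∫ Θ in (0 : ℝ)..1, J Q Θ :=
      intervalIntegral.integral_mono_interval le_rfl hτ.1 hτ.2
        (Filter.Eventually.of_forall (hJ0 hQ0)) (hJi hQc (right_mem_Icc.2 zero_le_one))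
    rw [hD, hLP, sqNormInitial_eq hR]
    change _ - _ = ∫ Θ in (0 : ℝ)..τ, J (spaceTimeDiv T (energyDensity U) (energyFlux A U)) Θ at hg
    linarith
  -- The factor `T` comes from bounding the height by `T`, the factor `2` from the `½` in the
  -- spacelike condition.
  have hder : ∀ τ ∈ Ioo (0 : ℝ) 1, J (energyDensity U) τ
      ≤ 2 * T * α * (∫ Θ in (0 : ℝ)..τ, J (energyDensity U) Θ) + 2 * T * D := by
    intro τ hτ
    have hτ' := Ioo_subset_Icc_self hτ
    have hslice := integrableOn_slice (R₁ := R₁) (R₂ := R₂) hT.le hE.continuousOn hτ'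
    have h1 : J (energyDensity U) τ
        ≤ ∫ y in K, T * energyDensity U (τ * profile T R₁ R₂ y, y) :=
      setIntegral_mono_on (integrableOn_profile_mul hT.le hE.continuousOn hτ')
        (hslice.const_mul T) measurableSet_closedBall fun y _ =>
        mul_le_mul_of_nonneg_right (profile_le hT.le y) (sq_nonneg _)
    have h2 : ∫ y in K, 1 / 2 * energyDensity U (τ * profile T R₁ R₂ y, y)
        ≤ ∫ y in K, fluxDensity T R₁ R₂ (energyDensity U) (energyFlux A U) τ y := by
      refine setIntegral_mono_on_ae (hslice.const_mul _)
        (integrableOn_fluxDensity hT hR1 hR hE hV hτ') measurableSet_closedBall ?_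
      filter_upwards [ae_norm_ne R₁ hR1.ne', ae_norm_ne R₂ (hR1.trans hR).ne'] with y a1 a2 hy
      exact half_energyDensity_le_fluxDensity hT hR1 hR hS ⟨hτ.1, hτ.2.le⟩ a1
        (lt_of_le_of_ne (mem_closedBall_zero_iff.1 hy) a2)
    rw [integral_const_mul] at h1 h2
    have h3 := h2.trans (hflux τ hτ')
    nlinarith
  have hG := gronwall_le (E := fun τ => ∫ Θ in (0 : ℝ)..τ, J (energyDensity U) Θ)
    (b := fun _ => 2 * T * α) (N := fun _ => 2 * T * D) zero_le_one
    (continuousOn_primitive zero_le_one (hJc hE.continuousOn)) continuousOn_const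
    continuousOn_const (fun _ _ => by positivity) (fun _ _ => by positivity)
    (fun τ hτ => ⟨_, hasDerivAt_primitive (hJc hE.continuousOn) hτ, hder τ hτ⟩)
  simp only [intervalIntegral.integral_const, sub_zero, one_smul, intervalIntegral.integral_same,
    zero_add] at hG
  rw [hLU]
  exact hG.trans_eq (by ring)

end LensEstimate

end SymHyp

end

theorem lemma2p5 {n m : ℕ} (T : ℝ) (hT : 0 < T)
    (A : Fin n → ℝ × SymHyp.Rn n → SymHyp.Mat m) (B : ℝ × SymHyp.Rn n → SymHyp.Mat m)
    (hP : SymHyp.IsSymmetricHyperbolic T A B) :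
    (∀ R₁ R₂ : ℝ, 0 < R₁ → R₁ < R₂ → SymHyp.IsSpacelikeLens A T R₁ R₂ →
      ∀ U : ℝ × SymHyp.Rn n → SymHyp.Cm m, ContDiffOn ℝ ∞ U (SymHyp.strip n T) →
        SymHyp.sqNormLens T R₁ R₂ U ≤
          2 * T * Real.exp (2 * T * SymHyp.alphaLens A B T R₁ R₂) *
            (SymHyp.sqNormInitial T R₁ R₂ U +
              SymHyp.sqNormLens T R₁ R₂ (SymHyp.opP T A B U))) ∧
    (∀ U : ℝ → SymHyp.H1 n m,
      ContDiffOn ℝ 1 (fun s => SymHyp.H1.toL2 (U s)) (Icc 0 T) → ContinuousOn U (Icc 0 T) →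
        ∀ t ∈ Icc 0 T,
          ‖SymHyp.H1.toL2 (U t)‖ ^ 2 ≤
            Real.exp (∫ s in (0 : ℝ)..t, SymHyp.beta A B s) *
              (‖SymHyp.H1.toL2 (U 0)‖ ^ 2 +
                SymHyp.sqNormOmega (SymHyp.opPH1 T A B U) t)) := by
  exact ⟨fun _ _ hR1 hR hS _ hU => SymHyp.energy_estimate_lens hT hP hR1 hR hS hU,
    fun U hU hU1 _ ht => SymHyp.energy_estimate_H1 hT hP U hU hU1 ht⟩
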